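/- Let $n\ge 0$, let $1\le d_1<\dots<d_s\le n$, and let $W=\mathbb C^{n+1}$ with basis $w_1,\dots,w_{n+1}$; let $pr_k:W\to W$ be the projection along $w_k$ onto the span of the other basis vectors. The degenerate partial flag variety is $$\mathcal F^a_{\mathbf d}=\Big\{(V_1,\dots,V_s)\in\prod_{i=1}^s \mathrm{Gr}_{d_i}(W)\ :\ pr_{d_i+1}\cdots pr_{d_{i+1}}V_i\subset V_{i+1},\ 1\le i<s\Big\}.$$ Let $Q$ be the equioriented quiver $1\to2\to\dots\to n$ with indecomposable projectives $P_k$ and injectives $I_k$, and let $P=\bigoplus_{k=1}^n P_k$, $I=\bigoplus_{k=1}^n I_k$. At every vertex $v$, $(P\oplus I)_v$ has a basis $w_{v,1},\dots,w_{v,n+1}$ with $w_{v,j}\in P_j$ for $j\le v$ and $w_{v,j}\in I_{j-1}$ for $j>v$; under $w_{v,j}\leftrightarrow w_j$ it is identified with $W$, and the arrow $v\to v+1$ becomes $pr_{v+1}$. The group $$G=\begin{bmatrix}\mathrm{Aut}_Q(P)&0\\ \mathrm{Hom}_Q(P,I)&\mathrm{Aut}_Q(I)\end{bmatrix}\subset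 \mathrm{Aut}_Q(P\oplus I),\qquad g=(g_1,\dots,g_n),$$ acts on $\mathcal F^a_{\mathbf d}$ by $g\cdot(V_1,\dots,V_s)=(g_{d_1}V_1,\dots,g_{d_s}V_s)$. For a subset $L\subset\{1,\dots,n+1\}$ of cardinality $d$ let $p_L\in\mathrm{Gr}_d(W)$ be the span of the $w_l$, $l\in L$, and let $C_L\subset \mathrm{Gr}_d(W)$ be the set of subspaces having a basis $(e_l)_{l\in L}$ of the form $$e_l=w_l+\sum_{p=1}^{l-1}c_pw_p+\sum_{p=d+1}^{n+1}c_pw_p\ \ (l\le d),\qquad e_l=w_l+\sum_{p=d+1}^{l-1}c_pw_p\ \ (l>d),$$ with constants $c_p\in\mathbb C$ depending on $l$. For subsets $L^i$ with $\#L^i=d_i$ put $p_{L^1,\dots,L^s}=(p_{L^1},\dots,p_{L^s})$. Give the summands $P_k,I_k$ of $P\oplus I$ integer degrees such that $\deg P_n<\dots<\deg P_1<\deg I_n<\dots<\deg I_1$, and let $\mathbb C^*$ act by $\lambda\cdot w_{v,j}=\lambda^{\deg w_{v,j}}w_{v,j}$, where $w_{v,j}$ has the degree of the summand containing it; this induces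 an action on $\mathcal F^a_{\mathbf d}$, using the vertices $d_1,\dots,d_s$. **Theorem.** 1. A point of $\mathcal F^a_{\mathbf d}$ is fixed by the torus of diagonal matrices $w_j\mapsto t_jw_j$ if and only if it is of the form $p_{L^1,\dots,L^s}$, and if and only if it is fixed by the one-dimensional torus. 2. Each $G$-orbit in $\mathcal F^a_{\mathbf d}$ contains exactly one torus-fixed point $p_{L^1,\dots,L^s}$. 3. If $p_{L^1,\dots,L^s}\in\mathcal F^a_{\mathbf d}$, then $G\cdot p_{L^1,\dots,L^s}=\mathcal F^a_{\mathbf d}\cap\prod_{i=1}^s C_{L^i}$. 4. The $G$-orbits form a decomposition of $\mathcal F^a_{\mathbf d}$ into finitely many pairwise disjoint cells, i.e. Zariski locally closed subsets isomorphic, as algebraic varieties, to affine spaces $\mathbb C^N$. It is the same decomposition as that into Feigin's cells $\mathcal F^a_{\mathbf d}\cap\prod_{i=1}^s C_{L^i}$, labelled by the $(L^1,\dots,L^s)$ with $p_{L^1,\dots,L^s}\in\mathcal F^a_{\mathbf d}$. 5. For every torus-fixed point $p$ of $\mathcal F^a_{\mathbf d}$ the attracting set $\{x\in\mathcal F^a_{\mathbf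 d}:\lim_{\lambda\to0}\lambda\cdot x=p\}$ of the one-dimensional torus is the orbit $G\cdot p$. 6. For the one-dimensional torus $\lambda\cdot w_{v,j}=\lambda^{j-2}w_{v,j}$ $(j>v)$, $\lambda\cdot w_{v,j}=\lambda^{j+n-1}w_{v,j}$ $(j\le v)$, the fixed points are the same, and $G\cdot p=\{x\in\mathcal F^a_{\mathbf d}:\lim_{\lambda\to\infty}\lambda\cdot x=p\}$ for every fixed point $p$. -/

import Mathlib

open Filter Topology

noncomputable section

namespace DegFlag

/-- The space `W = ℂ^(n+1)`.  The basis vector `w_j`, `1 ≤ j ≤ n+1`, of the text is `w ⟨j-1, _⟩` here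
(indices start at `0`). -/
abbrev W (n : ℕ) : Type := Fin (n + 1) → ℂ

/-- The standard basis vectors of `W`. -/
def w {n : ℕ} (j : Fin (n + 1)) : W n := Pi.single j 1

/-! ### The representation `P ⊕ I` of the equioriented quiver `1 → 2 → ⋯ → n`

The vertices are numbered by `v = 1, …, n`.  At every vertex `v` the space `(P ⊕ I)_v` has the basis
`w_{v,1}, …, w_{v,n+1}`, where `w_{v,j}` lies in the summand `P_j` if `j ≤ v` and in the summand
`I_{j-1}` if `j > v`.  Sending `w_{v,j}` to `w_j` identifies `(P ⊕ I)_v` with `W`; the arrow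
`v → v+1` becomes the projection `pr_{v+1}` along `w_{v+1}`. -/

/-- The composite projection `pr_{a+1} ∘ ⋯ ∘ pr_b : W → W`: it kills `w_{a+1}, …, w_b` and fixes the
other basis vectors. -/
def prBetween (n a b : ℕ) : W n →ₗ[ℂ] W n where
  toFun x := fun j => if a ≤ (j : ℕ) ∧ (j : ℕ) < b then 0 else x j
  map_add' x y := by
    funext j
    by_cases h : a ≤ (j : ℕ) ∧ (j : ℕ) < b <;> simp [h]
  map_smul' c x := by
    funext j
    by_cases h : a ≤ (j : ℕ) ∧ (j : ℕ) < b <;> simp [h]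

/-- The map of `P ⊕ I` attached to the arrow `v → v+1`: the projection `pr_{v+1}` along `w_{v+1}`. -/
def arrow (n v : ℕ) : W n →ₗ[ℂ] W n := prBetween n v (v + 1)

/-- Going along the arrows from `a` to `b` is the composite projection. -/
theorem prBetween_succ (n a b : ℕ) (h : a ≤ b) :
    prBetween n a (b + 1) = (arrow n b).comp (prBetween n a b) := by
  ext1 j
  ext1
  funext k
  simp only [prBetween, arrow, LinearMap.comp_apply, LinearMap.coe_mk, AddHom.coe_mk]
  split_ifs <;> first | rfl | omega

/-- The subspace `I_v` of `(P ⊕ I)_v`, spanned by `w_{v+1}, …, w_{n+1}`. -/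
def injPart (n v : ℕ) : Submodule ℂ (W n) := Submodule.span ℂ {x | ∃ j : Fin (n + 1), v ≤ (j : ℕ) ∧ x = w j}

/-- The group `G = [[Aut P, 0], [Hom (P, I), Aut I]]`: the automorphisms `(g_1, …, g_n)` of the
representation `P ⊕ I` (families commuting with the arrows) whose component `I → P` vanishes, i.e.
which map `I` to itself.  The entry `g k`, `k : Fin n`, is the component at the vertex `k + 1`. -/
def G (n : ℕ) : Subgroup (Fin n → (W n ≃ₗ[ℂ] W n)) where
  carrier := {g |
    (∀ (k : Fin n) (h : (k : ℕ) + 1 < n) (x : W n),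
      g ⟨k + 1, h⟩ (arrow n (k + 1) x) = arrow n (k + 1) (g k x)) ∧
    ∀ k : Fin n, (injPart n (k + 1)).map (g k : W n →ₗ[ℂ] W n) = injPart n (k + 1)}
  one_mem' := by
    refine ⟨fun k h x => rfl, fun k => ?_⟩
    exact Submodule.map_id _
  mul_mem' := by
    rintro g g' ⟨h1, h2⟩ ⟨h1', h2'⟩
    refine ⟨fun k h x => ?_, fun k => ?_⟩
    · simp only [Pi.mul_apply, LinearEquiv.mul_apply]
      rw [h1', h1]
    · have : (((g * g') k : W n ≃ₗ[ℂ] W n) : W n →ₗ[ℂ] W n)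
          = (g k : W n →ₗ[ℂ] W n).comp (g' k : W n →ₗ[ℂ] W n) := rfl
      rw [this, Submodule.map_comp, h2', h2]
  inv_mem' := by
    rintro g ⟨h1, h2⟩
    refine ⟨fun k h x => ?_, fun k => ?_⟩
    · apply (g ⟨k + 1, h⟩).injective
      rw [h1]
      change (g ⟨k + 1, h⟩) ((g ⟨k + 1, h⟩).symm _) = arrow n (k + 1) (g k ((g k).symm x))
      simp
    · conv_lhs => rw [← h2 k]
      rw [← Submodule.map_comp]
      have : (((g⁻¹) k : W n ≃ₗ[ℂ] W n) : W n →ₗ[ℂ] W n).comp (g k : W n →ₗ[ℂ] W n)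
          = LinearMap.id := by
        ext1 x
        ext1
        change (g k).symm (g k _) = _
        simp
      rw [this, Submodule.map_id]

/-! ### Grassmannians and degenerate flag varieties -/

/-- The Grassmannian of `k`-dimensional subspaces of `W`. -/
def Gr (n k : ℕ) : Type := {V : Submodule ℂ (W n) // Module.finrank ℂ V = k}

/-- The linear span of a linearly independent `k`-tuple of vectors. -/
def Gr.ofFrame {n k : ℕ} (A : {A : Fin k → W n // LinearIndependent ℂ A}) : Gr n k :=
  ⟨Submodule.span ℂ (Set.range A.1), by simpa using finrank_span_eq_card A.2⟩

/-- The classical (complex) topology of the Grassmannian: the quotient topology of the space of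
linearly independent `k`-tuples. -/
instance (n k : ℕ) : TopologicalSpace (Gr n k) :=
  TopologicalSpace.coinduced Gr.ofFrame inferInstance

/-- The image of a subspace under an invertible linear map. -/
def Gr.map {n k : ℕ} (g : W n ≃ₗ[ℂ] W n) (V : Gr n k) : Gr n k :=
  ⟨V.1.map (g : W n →ₗ[ℂ] W n), by rw [LinearEquiv.finrank_map_eq]; exact V.2⟩

/-- A dimension sequence `1 ≤ d_1 < ⋯ < d_s ≤ n` is encoded by a strictly monotone `d : Fin s → Fin n`
with `d_{i+1} = d i + 1`, so that `d i` is also the position of the vertex `d_{i+1}` of the quiver.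
`MultiGr d` is the product of the Grassmannians `Gr_{d_i}(W)`, with the product topology. -/
abbrev MultiGr {n s : ℕ} (d : Fin s → Fin n) : Type := ∀ i : Fin s, Gr n ((d i : ℕ) + 1)

/-- The degenerate partial flag variety:
`pr_{d_i + 1} ⋯ pr_{d_{i+1}} V_i ⊆ V_{i+1}` for consecutive indices. -/
def degFlag {n s : ℕ} (d : Fin s → Fin n) : Set (MultiGr d) :=
  {V | ∀ (i : Fin s) (h : (i : ℕ) + 1 < s),
    (V i).1.map (prBetween n ((d i : ℕ) + 1) ((d ⟨i + 1, h⟩ : ℕ) + 1)) ≤ (V ⟨i + 1, h⟩).1}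

/-- The orbit of `V` under `G`; the element `(g_1, …, g_n)` acts on the `i`-th subspace by
`g_{d_i}`. -/
def orbit {n s : ℕ} (d : Fin s → Fin n) (V : MultiGr d) : Set (MultiGr d) :=
  {V' | ∃ g ∈ G n, V' = fun i => (V i).map (g (d i))}

/-! ### Torus actions and fixed points -/

/-- The diagonal automorphism `w_j ↦ t_j w_j`. -/
def diagEquiv {n : ℕ} (t : Fin (n + 1) → ℂˣ) : W n ≃ₗ[ℂ] W n :=
  LinearEquiv.piCongrRight fun j => LinearEquiv.smulOfUnit (t j)

/-- Fixed points of the torus of diagonal matrices, acting by `w_{v,j} ↦ t_j w_{v,j}` at every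
vertex `v`. -/
def TorusFixed {n s : ℕ} {d : Fin s → Fin n} (V : MultiGr d) : Prop :=
  ∀ t : Fin (n + 1) → ℂˣ, (fun i => (V i).map (diagEquiv t)) = V

/-- The degree of `w_{v,j}`, when the summand `P_k` has degree `degP k` and the summand `I_k` has
degree `degI k` (`1 ≤ k ≤ n`): it is `degP j` if `j ≤ v` and `degI (j-1)` if `j > v`.
(Here `j` is `(j : ℕ) + 1`.) -/
def basisDegree {n : ℕ} (degP degI : ℕ → ℤ) (v : ℕ) (j : Fin (n + 1)) : ℤ :=
  if (j : ℕ) < v then degP (j + 1) else degI j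

/-- The action of the one-dimensional torus by `λ · w_{v,j} = λ ^ deg(w_{v,j}) w_{v,j}`. -/
def torusAct {n s : ℕ} (d : Fin s → Fin n) (degP degI : ℕ → ℤ) (z : ℂˣ) (V : MultiGr d) :
    MultiGr d :=
  fun i => (V i).map (diagEquiv fun j => z ^ basisDegree degP degI ((d i : ℕ) + 1) j)

/-- Fixed points of the one-dimensional torus. -/
def OneDimFixed {n s : ℕ} {d : Fin s → Fin n} (degP degI : ℕ → ℤ) (V : MultiGr d) : Prop :=
  ∀ z : ℂˣ, torusAct d degP degI z V = V

/-- Admissible degrees of the summands `P_1, …, P_n, I_1, …, I_n`: they are pairwise different,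
`deg L < deg L'` whenever `L ≠ L'` and `Hom (L, L') ≠ 0`, and the degrees of the `I_k` exceed those
of the `P_k`.  For the quiver `1 → ⋯ → n` one has `Hom (P_k, P_l) ≠ 0` iff `l ≤ k`,
`Hom (I_k, I_l) ≠ 0` iff `l ≤ k`, and `Hom (P_k, I_l) ≠ 0` iff `k ≤ l`. -/
structure AdmissibleDegrees (n : ℕ) (degP degI : ℕ → ℤ) : Prop where
  proj : ∀ k l, 1 ≤ l → l < k → k ≤ n → degP k < degP l
  inj : ∀ k l, 1 ≤ l → l < k → k ≤ n → degI k < degI l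
  proj_inj : ∀ k l, 1 ≤ k → k ≤ n → 1 ≤ l → l ≤ n → degP k < degI l

/-- The degree `j + n - 1` of `w_{v,j}`, `j ≤ v`, as a degree of the summand `P_j`. -/
def stdDegP (n : ℕ) (k : ℕ) : ℤ := (k : ℤ) + n - 1

/-- The degree `j - 2` of `w_{v,j}`, `j > v`, as a degree of the summand `I_{j-1}`. -/
def stdDegI (k : ℕ) : ℤ := (k : ℤ) - 1

/-- The points `y` of `X` with `λ · y → x` as `λ` runs along the filter `l`. -/
def attractingSet {n s : ℕ} {d : Fin s → Fin n} (X : Set (MultiGr d))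
    (act : ℂˣ → MultiGr d → MultiGr d) (l : Filter ℂˣ) (x : MultiGr d) : Set (MultiGr d) :=
  {y | y ∈ X ∧ Tendsto (fun z => act z y) l (𝓝 x)}

/-- `λ → 0` in `ℂ^*`. -/
def toZero : Filter ℂˣ := comap Units.val (𝓝 0)

/-- `λ → ∞` in `ℂ^*`. -/
def toInfinity : Filter ℂˣ := comap Units.val (Bornology.cobounded ℂ)

/-! ### Labels and cells in the Grassmannian -/

/-- Labels `L = (l_1 < ⋯ < l_k)`: the `k`-element subsets of the index set of the basis. -/
def Label (n k : ℕ) : Type := {L : Finset (Fin (n + 1)) // L.card = k}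

/-- The vector `w_{l} + ∑_{p < l} c_p w_p + ∑_{p > k} c_p w_p` if `l ≤ k`, and
`w_{l} + ∑_{k < p < l} c_p w_p` if `l > k` (in indices starting at `1`). -/
def cellVec {n : ℕ} (k : ℕ) (l : Fin (n + 1)) (c : Fin (n + 1) → ℂ) : W n :=
  if (l : ℕ) < k then
    w l + ∑ p with p < l, c p • w p + ∑ p with k ≤ ((p : Fin (n + 1)) : ℕ), c p • w p
  else
    w l + ∑ p with k ≤ ((p : Fin (n + 1)) : ℕ) ∧ p < l, c p • w p

/-- The cell `C_L` of the Grassmannian `Gr_k(W)`: subspaces with a basis `(e_l)_{l ∈ L}` consisting of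
vectors of the above form. -/
def grCell {n k : ℕ} (L : Label n k) : Set (Gr n k) :=
  {V | ∃ c : Fin (n + 1) → Fin (n + 1) → ℂ,
    LinearIndependent ℂ (fun l : L.1 => cellVec k l.1 (c l.1)) ∧
    Submodule.span ℂ (Set.range fun l : L.1 => cellVec k l.1 (c l.1)) = V.1}

/-- The point `p_L`: the span of the `w_l`, `l ∈ L`. -/
def fixedPt {n k : ℕ} (L : Label n k) : Gr n k :=
  ⟨Submodule.span ℂ (Set.range fun l : L.1 => (w l.1 : W n)), by
    have h : LinearIndependent ℂ (fun l : L.1 => (w l.1 : W n)) := by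
      have := (Pi.basisFun ℂ (Fin (n + 1))).linearIndependent.comp
        (fun l : L.1 => l.1) Subtype.val_injective
      convert this using 2 with l
      simp [w]
    rw [finrank_span_eq_card h]
    simpa using L.2⟩

/-- A collection of labels `L^1, …, L^s`. -/
abbrev MultiLabel {n s : ℕ} (d : Fin s → Fin n) : Type := ∀ i : Fin s, Label n ((d i : ℕ) + 1)

/-- The point `p_{L^1, …, L^s}`. -/
def multiFixedPt {n s : ℕ} {d : Fin s → Fin n} (L : MultiLabel d) : MultiGr d :=
  fun i => fixedPt (L i)

/-- The product of the cells `C_{L^i}`. -/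
def multiCell {n s : ℕ} {d : Fin s → Fin n} (L : MultiLabel d) : Set (MultiGr d) :=
  {V | ∀ i, V i ∈ grCell (L i)}

/-! ### The algebraic structure of products of Grassmannians; affine cells -/

/-- Index set of the matrix entries: `(i, l, p)` is the entry `(l, p)` of the `i`-th matrix. -/
abbrev Entry (n s : ℕ) : Type := Fin s × Fin (n + 1) × Fin (n + 1)

/-- The standard affine charts.  The subspace `V_i` lies in the chart of `J_i` if it has a basis
`(A_l)_{l ∈ J_i}` whose `J_i × J_i`-block is the identity matrix; the remaining entries of this (unique)
basis are the affine coordinates of `V_i` in that chart.  Rows outside `J_i` are put to `0`. -/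
def IsChart {n s : ℕ} {d : Fin s → Fin n} (J : Fin s → Finset (Fin (n + 1)))
    (A : Entry n s → ℂ) (V : MultiGr d) : Prop :=
  ∀ i : Fin s,
    (∀ l ∉ J i, ∀ p, A (i, l, p) = 0) ∧
    (∀ l ∈ J i, ∀ m ∈ J i, A (i, l, m) = if l = m then 1 else 0) ∧
    Submodule.span ℂ (Set.range fun l : Fin (n + 1) => (fun p => A (i, l, p) : W n)) = (V i).1

/-- The open set of a chart where a polynomial in the affine coordinates does not vanish. -/
def basicOpen {n s : ℕ} (d : Fin s → Fin n) (J : Fin s → Finset (Fin (n + 1)))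
    (H : MvPolynomial (Entry n s) ℂ) : Set (MultiGr d) :=
  {V | ∃ A, IsChart J A V ∧ MvPolynomial.eval A H ≠ 0}

/-- The Zariski topology on the product of Grassmannians. -/
abbrev zariski {n s : ℕ} (d : Fin s → Fin n) : TopologicalSpace (MultiGr d) :=
  TopologicalSpace.generateFrom {U | ∃ J H, U = basicOpen d J H}

/-- Regular functions on a (locally closed) subset: locally, quotients of polynomials in the affine
coordinates of a chart. -/
def RegularOn {n s : ℕ} {d : Fin s → Fin n} (Z : Set (MultiGr d)) (f : MultiGr d → ℂ) : Prop :=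
  ∀ z ∈ Z, ∃ (J : Fin s → Finset (Fin (n + 1))) (F H : MvPolynomial (Entry n s) ℂ),
    z ∈ basicOpen d J H ∧
    ∀ y ∈ Z, ∀ A, IsChart J A y → MvPolynomial.eval A H ≠ 0 →
      f y = MvPolynomial.eval A F / MvPolynomial.eval A H

/-- Regular maps from the affine space `ℂ^N`: locally, the affine coordinates of `φ x` in some chart
are rational functions of `x` without poles. -/
def RegularMap {n s N : ℕ} {d : Fin s → Fin n} (φ : (Fin N → ℂ) → MultiGr d) : Prop :=
  ∀ x₀, ∃ (J : Fin s → Finset (Fin (n + 1))) (F : Entry n s → MvPolynomial (Fin N) ℂ)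
    (H : MvPolynomial (Fin N) ℂ), MvPolynomial.eval x₀ H ≠ 0 ∧
    ∀ x, MvPolynomial.eval x H ≠ 0 →
      IsChart J (fun e => MvPolynomial.eval x (F e) / MvPolynomial.eval x H) (φ x)

/-- A cell: a Zariski locally closed subset which is isomorphic, as an algebraic variety, to an affine
space `ℂ^N`. -/
def IsCell {n s : ℕ} {d : Fin s → Fin n} (Z : Set (MultiGr d)) : Prop :=
  @IsLocallyClosed _ (zariski d) Z ∧
  ∃ (N : ℕ) (φ : (Fin N → ℂ) → MultiGr d) (ψ : MultiGr d → (Fin N → ℂ)),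
    RegularMap φ ∧ Set.range φ = Z ∧ (∀ x, ψ (φ x) = x) ∧ ∀ a, RegularOn Z fun V => ψ V a

/-- A decomposition of `X` into a finite disjoint union of cells. -/
structure IsCellularDecomposition {n s : ℕ} {d : Fin s → Fin n} (X : Set (MultiGr d))
    (𝒞 : Set (Set (MultiGr d))) : Prop where
  finite : 𝒞.Finite
  disjoint : 𝒞.PairwiseDisjoint id
  union : ⋃₀ 𝒞 = X
  cell : ∀ C ∈ 𝒞, IsCell C

/-- The collection of `G`-orbits on the degenerate flag variety. -/
def orbits {n s : ℕ} (d : Fin s → Fin n) : Set (Set (MultiGr d)) :=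
  {C | ∃ V ∈ degFlag d, C = orbit d V}

/-- The collection of the cells `C_{L^1, …, L^s} = F^a_d ∩ ∏ C_{L^i}`, labelled by the collections with
`p_{L^1, …, L^s} ∈ F^a_d`. -/
def labelledCells {n s : ℕ} (d : Fin s → Fin n) : Set (Set (MultiGr d)) :=
  {C | ∃ L : MultiLabel d, multiFixedPt L ∈ degFlag d ∧ C = degFlag d ∩ multiCell L}

end DegFlag

end

/-! At the vertex `v`, order the basis as `w_{v+1}, …, w_{n+1}, w_1, …, w_v` and attach to a
subspace its label: the set of leading (that is, last nonzero) indices of its vectors. By Gaussian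
elimination this set has as many elements as the dimension, and `C_L` is exactly the set of
subspaces with label `L` (`mem_grCell_iff`). Families that commute with the arrows and preserve `I`
are triangular for this order at every vertex (`G_triangular`), so labels are constant on
`G`-orbits.

The main point is the converse (`multiFixedPt_multiLabel_mem_orbit`): a point `V` of the variety is
a `G`-translate of the fixed point `p_L` with the same labels. The indecomposable summand of `P ⊕ I`
through `w_l` is sent to the multiples of one vector and its projections. This vector is the reduced
basis vector of `V_i` with leading index `l`, for the first `i` on the same side of `l` (`P` or `I`)
whose label contains `l`. The incidence conditions keep its projections inside the later `V_j`. The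
resulting endomorphism is triangular with diagonal `1`, hence an automorphism in `G`. So orbits,
nonempty cells and labels correspond. As a subspace stable under a diagonal map with distinct
entries is a coordinate subspace, each orbit has exactly one torus-fixed point.

In the standard chart of its label a cell is given by polynomial equations, hence is locally closed.
They can be solved recursively in `i`: a row `l` of the next matrix is determined by the preceding
matrix when `l` belongs to the preceding label and survives the projection, and is otherwise free.
The free entries are affine coordinates (`isCell_of_linked`).

The one-dimensional torus multiplies the entry `(l, p)` of a reduced basis by `λ ^ (deg p - deg l)`.
This tends to `0` for `p` before `l`, so every point flows to the fixed point of its label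
(`tendsto_map_diagEquiv`). Minors separate distinct fixed points, so the attracting sets are the
cells. -/

namespace DegFlag

/-! ### Leading indices and reduced bases -/

/-- `l` is the leading index of `x` for the order of the indices given by `r`. -/
def IsLead {ι : Type*} (r : ι → ℕ) (l : ι) (x : ι → ℂ) : Prop :=
  x l ≠ 0 ∧ ∀ p, r l < r p → x p = 0

open Classical in
/-- The set of leading indices of the vectors of a subspace. -/
noncomputable def leadSet {ι : Type*} [Fintype ι] (r : ι → ℕ) (V : Submodule ℂ (ι → ℂ)) :
    Finset ι :=
  Finset.univ.filter fun l => ∃ x ∈ V, IsLead r l x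

/-- The rows of `B` outside `J` vanish, the `J × J`-block is the identity, and the rows span `V`. -/
def IsRowChart {ι : Type*} [DecidableEq ι] (J : Finset ι) (B : ι → ι → ℂ)
    (V : Submodule ℂ (ι → ℂ)) : Prop :=
  (∀ l ∉ J, ∀ p, B l p = 0) ∧
  (∀ l ∈ J, ∀ m ∈ J, B l m = if l = m then 1 else 0) ∧
  Submodule.span ℂ (Set.range B) = V

section Leading

set_option linter.unusedSectionVars false

variable {ι : Type*} [Fintype ι] [DecidableEq ι] {r : ι → ℕ} {V : Submodule ℂ (ι → ℂ)}
  {J : Finset ι} {B : ι → ι → ℂ}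

theorem mem_leadSet {l : ι} : l ∈ leadSet r V ↔ ∃ x ∈ V, IsLead r l x := by
  simp [leadSet]

theorem exists_isLead (r : ι → ℕ) {x : ι → ℂ} (hx : x ≠ 0) :
    ∃ l, IsLead r l x := by
  classical
  obtain ⟨j, hj⟩ := Function.ne_iff.mp hx
  obtain ⟨l, hl, hmax⟩ := Finset.exists_max_image (Finset.univ.filter fun p => x p ≠ 0) r
    ⟨j, by simpa using hj⟩
  refine ⟨l, by simpa using hl, fun p hp => ?_⟩
  by_contra h
  exact absurd (hmax p (by simpa using h)) (by omega)

/-- The leading index of a nonzero vector of `V` lies in `leadSet r V`. Hence vectors of `V` are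
determined by their coordinates at the leading indices. -/
theorem eq_zero_of_forall_leadSet {x : ι → ℂ} (hx : x ∈ V)
    (h : ∀ l ∈ leadSet r V, x l = 0) : x = 0 := by
  by_contra hne
  obtain ⟨l, hl⟩ := exists_isLead r hne
  exact hl.1 (h l (mem_leadSet.2 ⟨x, hx, hl⟩))

theorem IsRowChart.row_mem (h : IsRowChart J B V) (l : ι) : B l ∈ V := by
  rw [← h.2.2]
  exact Submodule.subset_span ⟨l, rfl⟩

theorem IsRowChart.expand (h : IsRowChart J B V) {y : ι → ℂ} (hy : y ∈ V) :
    y = ∑ m, y m • B m := by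
  rw [← h.2.2] at hy
  induction hy using Submodule.span_induction with
  | mem x hx =>
    obtain ⟨l, rfl⟩ := hx
    by_cases hl : l ∈ J
    · rw [Finset.sum_eq_single l]
      · simp [h.2.1 l hl l hl]
      · intro m _ hm
        by_cases hmJ : m ∈ J
        · simp [h.2.1 l hl m hmJ, hm.symm]
        · have : B m = 0 := funext (h.1 m hmJ)
          simp [this]
      · simp
    · have : B l = 0 := funext (h.1 l hl)
      simp [this]
  | zero => simp
  | add x y _ _ hx hy =>
    conv_lhs => rw [hx, hy]
    simp [add_smul, Finset.sum_add_distrib]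
  | smul c x _ hx =>
    conv_lhs => rw [hx]
    simp [Finset.smul_sum, smul_smul]

theorem IsRowChart.unique {B' : ι → ι → ℂ} (h : IsRowChart J B V) (h' : IsRowChart J B' V) :
    B = B' := by
  funext l
  by_cases hl : l ∈ J
  · rw [h'.expand (h.row_mem l), Finset.sum_eq_single l]
    · simp [h.2.1 l hl l hl]
    · intro m _ hm
      by_cases hmJ : m ∈ J
      · simp [h.2.1 l hl m hmJ, hm.symm]
      · have : B' m = 0 := funext (h'.1 m hmJ)
        simp [this]
    · simp
  · funext p
    rw [h.1 l hl, h'.1 l hl]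

theorem IsRowChart.linearIndependent (h : IsRowChart J B V) :
    LinearIndependent ℂ (fun l : J => B l) := by
  rw [Fintype.linearIndependent_iff]
  intro g hg m
  have := congrFun hg m
  simp only [Finset.sum_apply, Pi.smul_apply, smul_eq_mul, Pi.zero_apply] at this
  rw [Finset.sum_eq_single m] at this
  · simpa [h.2.1 m m.2 m m.2] using this
  · intro l _ hl
    have hlm : (l : ι) ≠ m := fun e => hl (Subtype.ext e)
    simp [h.2.1 l l.2 m m.2, hlm]
  · simp

theorem IsRowChart.span_eq (h : IsRowChart J B V) :
    Submodule.span ℂ (Set.range fun l : J => B l) = V := by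
  rw [← h.2.2]
  apply le_antisymm
  · apply Submodule.span_mono
    rintro _ ⟨l, rfl⟩
    exact ⟨l, rfl⟩
  · rw [Submodule.span_le]
    rintro _ ⟨l, rfl⟩
    by_cases hl : l ∈ J
    · exact Submodule.subset_span ⟨⟨l, hl⟩, rfl⟩
    · have : B l = 0 := funext (h.1 l hl)
      rw [this]
      exact Submodule.zero_mem _

theorem IsRowChart.finrank (h : IsRowChart J B V) : Module.finrank ℂ V = J.card := by
  rw [← h.span_eq, finrank_span_eq_card h.linearIndependent, Fintype.card_coe]

/-- Reduced echelon form. -/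
theorem exists_isRowChart_leadSet (hr : Function.Injective r) (V : Submodule ℂ (ι → ℂ)) :
    ∃ B, IsRowChart (leadSet r V) B V ∧ ∀ l p, r l < r p → B l p = 0 := by
  -- Elimination by induction on the position of `l`: from a vector leading at `l`, subtract the
  -- reduced vectors already built at the earlier leading indices, then normalise.
  have key : ∀ N : ℕ, ∀ l ∈ leadSet r V, r l < N → ∃ e ∈ V, (∀ p, r l < r p → e p = 0) ∧
      ∀ m ∈ leadSet r V, e m = if l = m then 1 else 0 := by
    intro N
    induction N with
    | zero => intro l _ h; omega
    | succ N ih =>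
      intro l hl hlN
      choose! e he using ih
      obtain ⟨x, hxV, hx0, hx⟩ := mem_leadSet.1 hl
      set S := (leadSet r V).filter fun m => r m < r l with hS
      have heS : ∀ m ∈ S, e m ∈ V ∧ (∀ p, r m < r p → e m p = 0) ∧
          ∀ q ∈ leadSet r V, e m q = if m = q then 1 else 0 := by
        intro m hm
        have := Finset.mem_filter.1 hm
        exact he m this.1 (by omega)
      refine ⟨(x l)⁻¹ • (x - ∑ m ∈ S, x m • e m), ?_, ?_, ?_⟩
      · exact V.smul_mem _ (V.sub_mem hxV (V.sum_mem fun m hm => V.smul_mem _ (heS m hm).1))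
      · intro p hp
        have : ∑ m ∈ S, x m * e m p = 0 := Finset.sum_eq_zero fun m hm => by
          rw [(heS m hm).2.1 p (lt_trans (Finset.mem_filter.1 hm).2 hp), mul_zero]
        simp [hx p hp, this]
      · intro q hq
        have hsum : ∑ m ∈ S, x m * e m q = if q ∈ S then x q else 0 := by
          rw [← Finset.sum_ite_eq' S q x]
          refine Finset.sum_congr rfl fun m hm => ?_
          rw [(heS m hm).2.2 q hq]
          simp
        simp only [Pi.smul_apply, Pi.sub_apply, Finset.sum_apply, smul_eq_mul, hsum]
        rcases lt_trichotomy (r q) (r l) with h | h | h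
        · have h1 : q ∈ S := Finset.mem_filter.2 ⟨hq, h⟩
          have h2 : l ≠ q := by rintro rfl; omega
          simp [h1, h2]
        · have h2 := hr h
          subst h2
          have h1 : q ∉ S := fun h => by simpa using (Finset.mem_filter.1 h).2
          simp [h1, hx0]
        · have h1 : q ∉ S := fun h' => by have := (Finset.mem_filter.1 h').2; omega
          have h2 : l ≠ q := by rintro rfl; omega
          simp [h1, h2, hx q h]
  have key' : ∀ l ∈ leadSet r V, ∃ e ∈ V, (∀ p, r l < r p → e p = 0) ∧
      ∀ m ∈ leadSet r V, e m = if l = m then 1 else 0 :=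
    fun l hl => key (r l + 1) l hl (Nat.lt_succ_self _)
  choose! e he using key'
  refine ⟨fun l => if l ∈ leadSet r V then e l else 0, ⟨?_, ?_, ?_⟩, ?_⟩
  · intro l hl p
    simp [hl]
  · intro l hl m hm
    simp only [hl, if_true]
    exact (he l hl).2.2 m hm
  · apply le_antisymm
    · rw [Submodule.span_le]
      rintro _ ⟨l, rfl⟩
      by_cases hl : l ∈ leadSet r V
      · simpa [hl] using (he l hl).1
      · simp [hl]
    · intro x hx
      have : x = ∑ l ∈ leadSet r V, x l • e l := by
        rw [← sub_eq_zero]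
        refine eq_zero_of_forall_leadSet (r := r)
          (V.sub_mem hx (V.sum_mem fun m hm => V.smul_mem _ (he m hm).1)) fun q hq => ?_
        simp only [Pi.sub_apply, Finset.sum_apply, Pi.smul_apply, smul_eq_mul]
        rw [Finset.sum_eq_single q]
        · simp [(he q hq).2.2 q hq]
        · intro m hm hmq
          simp [(he m hm).2.2 q hq, hmq]
        · exact fun h => absurd hq h
      rw [this]
      refine Submodule.sum_mem _ fun l hl => Submodule.smul_mem _ _ (Submodule.subset_span ⟨l, ?_⟩)
      simp [hl]
  · intro l p hlp
    by_cases hl : l ∈ leadSet r V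
    · simpa [hl] using (he l hl).2.1 p hlp
    · simp [hl]

theorem card_leadSet (hr : Function.Injective r) (V : Submodule ℂ (ι → ℂ)) :
    (leadSet r V).card = Module.finrank ℂ V := by
  obtain ⟨B, hB, -⟩ := exists_isRowChart_leadSet hr V
  exact hB.finrank.symm

/-- The leading set has exactly `finrank V` elements, so one inclusion suffices to compute it. -/
theorem leadSet_eq_of_subset (hr : Function.Injective r)
    (h : ∀ l ∈ J, ∃ x ∈ V, IsLead r l x) (hJ : Module.finrank ℂ V ≤ J.card) :
    leadSet r V = J := by
  refine (Finset.eq_of_subset_of_card_le (fun l hl => mem_leadSet.2 (h l hl)) ?_).symm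
  rwa [card_leadSet hr]

theorem IsRowChart.leadSet_eq (hr : Function.Injective r) (h : IsRowChart J B V)
    (hB : ∀ l p, r l < r p → B l p = 0) : leadSet r V = J := by
  refine leadSet_eq_of_subset hr (fun l hl => ⟨B l, h.row_mem l, ?_, hB l⟩) h.finrank.le
  simp [h.2.1 l hl l hl]

/-- An injective linear map preserving leading indices preserves the set of leading indices. -/
theorem leadSet_map (hr : Function.Injective r) (g : (ι → ℂ) ≃ₗ[ℂ] (ι → ℂ))
    (hg : ∀ l x, IsLead r l x → IsLead r l (g x)) :
    leadSet r (V.map (g : (ι → ℂ) →ₗ[ℂ] (ι → ℂ))) = leadSet r V := by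
  refine leadSet_eq_of_subset hr (fun l hl => ?_) ?_
  · obtain ⟨x, hx, hl⟩ := mem_leadSet.1 hl
    exact ⟨g x, Submodule.mem_map_of_mem hx, hg l x hl⟩
  · rw [LinearEquiv.finrank_map_eq, card_leadSet hr]

/-- A subspace stable under a diagonal map with distinct entries is a coordinate subspace. -/
theorem isRowChart_single_of_diagonal_stable (hr : Function.Injective r) (c : ι → ℂ)
    (hc : Function.Injective c)
    (hV : ∀ x ∈ V, (fun p => c p * x p) ∈ V) :
    IsRowChart (leadSet r V) (fun l => if l ∈ leadSet r V then Pi.single l 1 else 0) V := by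
  obtain ⟨B, hB, -⟩ := exists_isRowChart_leadSet hr V
  convert hB using 1
  funext l
  by_cases hl : l ∈ leadSet r V
  · have h0 : (fun p => c p * B l p) - c l • B l = 0 := by
      refine eq_zero_of_forall_leadSet (r := r)
        (V.sub_mem (hV _ (hB.row_mem l)) (V.smul_mem _ (hB.row_mem l))) fun m hm => ?_
      have := hB.2.1 l hl m hm
      by_cases hlm : l = m
      · subst hlm; simp
      · simp [this, hlm]
    rw [if_pos hl]
    funext p
    by_cases hp : p = l
    · subst hp; simp [hB.2.1 p hl p hl]
    · have := congrFun h0 p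
      simp only [Pi.sub_apply, Pi.smul_apply, smul_eq_mul, Pi.zero_apply, ← sub_mul] at this
      rcases mul_eq_zero.1 this with h | h
      · exact absurd (hc (sub_eq_zero.1 h)) hp
      · simp [h, hp]
  · rw [if_neg hl]
    funext p
    exact (hB.1 l hl p).symm

end Leading

/-! ### The order of the basis at a vertex and the cells of the Grassmannian -/

/-- The position of a basis vector at the vertex `k`: the order is
`w_{k+1}, …, w_{n+1}, w_1, …, w_k`. -/
def pos (n k : ℕ) (j : Fin (n + 1)) : ℕ := if (j : ℕ) < k then j + n + 1 else j

theorem pos_injective (n k : ℕ) : Function.Injective (pos n k) := by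
  intro a b h
  have := a.2
  have := b.2
  unfold pos at h
  apply Fin.ext
  split_ifs at h <;> omega

/-- For the order `pos`, the two shapes of `e_l` become one: `w_l` plus a combination of earlier
basis vectors. -/
theorem cellVec_apply {n : ℕ} (k : ℕ) (l : Fin (n + 1)) (c : Fin (n + 1) → ℂ) (p : Fin (n + 1)) :
    cellVec k l c p = if p = l then 1 else if pos n k p < pos n k l then c p else 0 := by
  have hp := p.2
  have hl := l.2
  have hs : ∀ (P : Fin (n + 1) → Prop) [DecidablePred P],
      (∑ q with P q, c q • (w q : W n)) p = if P p then c p else 0 := by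
    intro P _
    simp [w, Finset.sum_apply, Pi.single_apply, Finset.sum_ite_eq]
  unfold cellVec pos
  rcases eq_or_ne p l with rfl | hpl
  · rw [if_pos rfl]
    split_ifs with h
    · simp only [Pi.add_apply, hs]
      simp [w, h]
    · simp only [Pi.add_apply, hs]
      simp [w]
  · have hpl' : (p : ℕ) ≠ l := fun h => hpl (Fin.ext h)
    split_ifs with h h1 h2 h2 h1 h2 h2 <;>
    · simp only [Pi.add_apply, hs]
      simp only [w, Pi.single_apply, hpl, if_false, Fin.lt_def, zero_add]
      split_ifs <;> first | omega | simp

theorem isLead_cellVec {n : ℕ} (k : ℕ) (l : Fin (n + 1)) (c : Fin (n + 1) → ℂ) :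
    IsLead (pos n k) l (cellVec k l c) := by
  refine ⟨by simp [cellVec_apply], fun p hp => ?_⟩
  rw [cellVec_apply, if_neg, if_neg (by omega)]
  rintro rfl
  omega

theorem cellVec_eq_self {n k : ℕ} {l : Fin (n + 1)} {c : Fin (n + 1) → ℂ} (h1 : c l = 1)
    (h2 : ∀ p, pos n k l < pos n k p → c p = 0) : cellVec k l c = c := by
  funext p
  rw [cellVec_apply]
  split_ifs with h h'
  · rw [h, h1]
  · rfl
  · refine (h2 p (lt_of_le_of_ne (not_lt.1 h') fun e => h (pos_injective n k e).symm)).symm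

theorem mem_grCell_iff {n k : ℕ} {L : Label n k} {V : Gr n k} :
    V ∈ grCell L ↔ leadSet (pos n k) V.1 = L.1 := by
  constructor
  · rintro ⟨c, -, hs⟩
    refine leadSet_eq_of_subset (pos_injective n k)
      (fun l hl => ⟨cellVec k l (c l), ?_, isLead_cellVec k l _⟩) ?_
    · rw [← hs]
      exact Submodule.subset_span ⟨⟨l, hl⟩, rfl⟩
    · rw [V.2, L.2]
  · intro h
    obtain ⟨B, hB, hBt⟩ := exists_isRowChart_leadSet (pos_injective n k) V.1
    rw [h] at hB
    have : (fun l : L.1 => cellVec k l.1 (B l.1)) = fun l : L.1 => B l := by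
      funext l
      exact cellVec_eq_self (by simp [hB.2.1 l l.2 l l.2]) (hBt l)
    refine ⟨B, ?_, ?_⟩
    · rw [this]; exact hB.linearIndependent
    · rw [this]; exact hB.span_eq

/-- The label of the cell containing a subspace. -/
noncomputable def label {n k : ℕ} (V : Gr n k) : Label n k :=
  ⟨leadSet (pos n k) V.1, by rw [card_leadSet (pos_injective n k), V.2]⟩

theorem mem_grCell_iff_label {n k : ℕ} {L : Label n k} {V : Gr n k} :
    V ∈ grCell L ↔ label V = L := by
  rw [mem_grCell_iff]
  exact ⟨fun h => Subtype.ext h, fun h => congrArg Subtype.val h⟩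

theorem mem_fixedPt_iff {n k : ℕ} {L : Label n k} {x : W n} :
    x ∈ (fixedPt L).1 ↔ ∀ p ∉ L.1, x p = 0 := by
  constructor
  · intro hx p hp
    change x ∈ Submodule.span ℂ _ at hx
    induction hx using Submodule.span_induction with
    | mem x hx =>
      obtain ⟨l, rfl⟩ := hx
      have : p ≠ l := by rintro rfl; exact hp l.2
      simp [w, this]
    | zero => rfl
    | add x y _ _ hx hy => simp [hx, hy]
    | smul c x _ hx => simp [hx]
  · intro h
    have : x = ∑ l, x l • (w l : W n) := by
      funext p
      simp [w, Finset.sum_apply, Pi.single_apply]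
    rw [this]
    refine Submodule.sum_mem _ fun l _ => ?_
    by_cases hl : l ∈ L.1
    · exact Submodule.smul_mem _ _ (Submodule.subset_span ⟨⟨l, hl⟩, rfl⟩)
    · simp [h l hl]

theorem label_fixedPt {n k : ℕ} (L : Label n k) : label (fixedPt L) = L := by
  apply Subtype.ext
  refine leadSet_eq_of_subset (pos_injective n k) (fun l hl => ⟨w l, ?_, ?_, ?_⟩) ?_
  · exact mem_fixedPt_iff.2 fun p hp => by
      have : p ≠ l := by rintro rfl; exact hp hl
      simp [w, this]
  · simp [w]
  · intro p hp
    have : p ≠ l := by rintro rfl; omega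
    simp [w, this]
  · rw [(fixedPt L).2, L.2]

/-- A subspace stable under a diagonal map with distinct entries is one of the points `p_L`. -/
theorem eq_fixedPt_of_diagonal_stable {n k : ℕ} {V : Gr n k} (c : Fin (n + 1) → ℂ)
    (hc : Function.Injective c) (hV : ∀ x ∈ V.1, (fun p => c p * x p) ∈ V.1) :
    V = fixedPt (label V) := by
  have h := (isRowChart_single_of_diagonal_stable (pos_injective n k) c hc hV).span_eq
  apply Subtype.ext
  rw [← h]
  change _ = Submodule.span ℂ _
  congr 2
  funext l
  have hl := l.2
  change (if l.1 ∈ leadSet (pos n k) V.1 then _ else _) = _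
  rw [if_pos hl]
  rfl

theorem map_diagEquiv_fixedPt {n k : ℕ} (L : Label n k) (t : Fin (n + 1) → ℂˣ) :
    (fixedPt L).map (diagEquiv t) = fixedPt L := by
  apply Subtype.ext
  apply Submodule.eq_of_le_of_finrank_eq
  · rintro _ ⟨x, hx, rfl⟩
    rw [mem_fixedPt_iff]
    intro p hp
    change (t p : ℂ) * x p = 0
    rw [mem_fixedPt_iff.1 hx p hp, mul_zero]
  · rw [((fixedPt L).map (diagEquiv t)).2, (fixedPt L).2]

/-! ### Triangular maps -/

theorem eq_sum_smul_w {n : ℕ} (x : W n) : x = ∑ l, x l • (w l : W n) := by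
  funext p
  simp [w, Finset.sum_apply, Pi.single_apply]

theorem map_apply_eq_sum {n : ℕ} (T : W n →ₗ[ℂ] W n) (x : W n) (p : Fin (n + 1)) :
    T x p = ∑ l, x l * T (w l) p := by
  conv_lhs => rw [eq_sum_smul_w x]
  simp [Finset.sum_apply]

theorem isLead_map_of_triangular {n : ℕ} {r : Fin (n + 1) → ℕ} (hr : Function.Injective r)
    (T : W n →ₗ[ℂ] W n) (hT : ∀ l p, r l < r p → T (w l) p = 0) (hd : ∀ l, T (w l) l ≠ 0)
    {l : Fin (n + 1)} {x : W n} (hx : IsLead r l x) : IsLead r l (T x) := by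
  constructor
  · rw [map_apply_eq_sum, Finset.sum_eq_single l]
    · exact mul_ne_zero hx.1 (hd l)
    · intro m _ hm
      rcases lt_or_gt_of_ne (fun e => hm (hr e) : r m ≠ r l) with h | h
      · rw [hT m l h, mul_zero]
      · rw [hx.2 m h, zero_mul]
    · simp
  · intro p hp
    rw [map_apply_eq_sum]
    refine Finset.sum_eq_zero fun m _ => ?_
    rcases lt_or_ge (r m) (r p) with h | h
    · rw [hT m p h, mul_zero]
    · rw [hx.2 m (by omega), zero_mul]

theorem injective_of_triangular {n : ℕ} {r : Fin (n + 1) → ℕ} (hr : Function.Injective r)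
    (T : W n →ₗ[ℂ] W n) (hT : ∀ l p, r l < r p → T (w l) p = 0) (hd : ∀ l, T (w l) l ≠ 0) :
    Function.Injective T := by
  rw [injective_iff_map_eq_zero]
  intro x hx
  by_contra hne
  obtain ⟨l, hl⟩ := exists_isLead r hne
  have := (isLead_map_of_triangular hr T hT hd hl).1
  simp [hx] at this

theorem mem_injPart_iff {n v : ℕ} {x : W n} :
    x ∈ injPart n v ↔ ∀ j : Fin (n + 1), (j : ℕ) < v → x j = 0 := by
  constructor
  · intro hx j hj
    unfold injPart at hx
    induction hx using Submodule.span_induction with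
    | mem x hx =>
      obtain ⟨l, hl, rfl⟩ := hx
      have : j ≠ l := by rintro rfl; omega
      simp [w, this]
    | zero => rfl
    | add x y _ _ hx hy => simp [hx, hy]
    | smul c x _ hx => simp [hx]
  · intro h
    rw [eq_sum_smul_w x]
    refine Submodule.sum_mem _ fun l _ => ?_
    by_cases hl : v ≤ (l : ℕ)
    · exact Submodule.smul_mem _ _ (Submodule.subset_span ⟨l, hl, rfl⟩)
    · simp [h l (by omega)]

theorem prBetween_apply (n a b : ℕ) (x : W n) (j : Fin (n + 1)) :
    prBetween n a b x j = if a ≤ (j : ℕ) ∧ (j : ℕ) < b then 0 else x j := rfl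

theorem prBetween_w (n a b : ℕ) (l : Fin (n + 1)) :
    prBetween n a b (w l) = if a ≤ (l : ℕ) ∧ (l : ℕ) < b then 0 else w l := by
  funext j
  rw [prBetween_apply]
  rcases eq_or_ne j l with rfl | h
  · split_ifs <;> simp
  · split_ifs <;> simp [w, h]

/-! ### The group acts by triangular maps -/

theorem G_prBetween {n : ℕ} {g : Fin n → (W n ≃ₗ[ℂ] W n)} (hg : g ∈ G n) {a b : Fin n}
    (hab : a ≤ b) (x : W n) :
    g b (prBetween n (a + 1) (b + 1) x) = prBetween n (a + 1) (b + 1) (g a x) := by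
  obtain ⟨b, hb⟩ := b
  have hab' : (a : ℕ) ≤ b := hab
  clear hab
  induction b, hab' using Nat.le_induction with
  | base =>
    have : ∀ y : W n, prBetween n (a + 1) (a + 1) y = y := fun y => by
      funext j
      rw [prBetween_apply, if_neg (by omega)]
    rw [this, this]
  | succ b hab ih =>
    have h1 := ih (by omega)
    have h2 := hg.1 ⟨b, by omega⟩ hb
    simp only at h1 h2 ⊢
    rw [prBetween_succ n _ _ (by omega : (a : ℕ) + 1 ≤ b + 1)]
    simp only [LinearMap.comp_apply]
    rw [h2, h1]

/-- If `w_l` lies in `P`, it is transported from the vertex where its summand starts, and the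
projections on the way kill the later coordinates of the image. If it lies in `I`, its image has no
`P`-part. Pushed on to the vertex where `w_l` dies, the image must die too, which excludes the
coordinates beyond `l`. -/
theorem G_triangular {n : ℕ} {g : Fin n → (W n ≃ₗ[ℂ] W n)} (hg : g ∈ G n) (k : Fin n)
    (l p : Fin (n + 1)) (h : pos n (k + 1) l < pos n (k + 1) p) : g k (w l) p = 0 := by
  have hk := k.2
  have hp := p.2
  have hl := l.2
  unfold pos at h
  by_cases hlk : (l : ℕ) < k + 1
  · rw [if_pos hlk] at h
    have hpk : (p : ℕ) < k + 1 := by by_contra hc; rw [if_neg hc] at h; omega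
    rw [if_pos hpk] at h
    have h1 := G_prBetween hg (a := ⟨l, by omega⟩) (b := k)
      (Fin.le_def.2 (by simp only; omega)) (w l)
    simp only at h1
    rw [prBetween_w, if_neg (by omega)] at h1
    rw [h1, prBetween_apply, if_pos (by omega)]
  · rw [if_neg hlk] at h
    by_cases hpk : (p : ℕ) < k + 1
    · have h1 : (w l : W n) ∈ injPart n (k + 1) := Submodule.subset_span ⟨l, by omega, rfl⟩
      have h2 : g k (w l) ∈ injPart n (k + 1) := by
        rw [← hg.2 k]
        exact Submodule.mem_map_of_mem h1
      exact mem_injPart_iff.1 h2 p hpk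
    · rw [if_neg hpk] at h
      have h1 := G_prBetween hg (a := k) (b := ⟨l, by omega⟩)
        (Fin.le_def.2 (by simp only; omega)) (w l)
      simp only at h1
      rw [prBetween_w, if_pos (by omega), map_zero] at h1
      have h2 := congrFun h1 p
      rw [prBetween_apply, if_neg (by omega)] at h2
      exact h2.symm

/-- The inverse lies in `G` and is triangular too, so the diagonal entries of the two maps multiply
to `1`. -/
theorem G_diagonal_ne_zero {n : ℕ} {g : Fin n → (W n ≃ₗ[ℂ] W n)} (hg : g ∈ G n) (k : Fin n)
    (l : Fin (n + 1)) : g k (w l) l ≠ 0 := by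
  intro h0
  have hinv := (G n).inv_mem hg
  have h1 : (g⁻¹) k (g k (w l)) = w l := (g k).symm_apply_apply _
  have h2 : (g⁻¹) k (g k (w l)) l = 0 := by
    have := map_apply_eq_sum (((g⁻¹) k : W n ≃ₗ[ℂ] W n) : W n →ₗ[ℂ] W n) (g k (w l)) l
    simp only [LinearEquiv.coe_coe] at this
    rw [this]
    refine Finset.sum_eq_zero fun m _ => ?_
    rcases lt_trichotomy (pos n (k + 1) m) (pos n (k + 1) l) with h | h | h
    · rw [G_triangular hinv k m l h, mul_zero]
    · rw [pos_injective _ _ h, h0, zero_mul]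
    · rw [G_triangular hg k l m h, zero_mul]
  rw [h1] at h2
  simp [w] at h2

theorem label_map_of_mem_G {n : ℕ} {g : Fin n → (W n ≃ₗ[ℂ] W n)} (hg : g ∈ G n) (k : Fin n)
    (V : Gr n (k + 1)) : label (V.map (g k)) = label V :=
  Subtype.ext <| leadSet_map (pos_injective n _) (g k) fun _ _ hx =>
    isLead_map_of_triangular (pos_injective n _) (g k : W n →ₗ[ℂ] W n) (G_triangular hg k)
      (G_diagonal_ne_zero hg k) hx

/-! ### Orbits and their labels -/

section OrbitsAndLabels

variable {n s : ℕ} {d : Fin s → Fin n}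

/-- The labels of the components of a point of the product of Grassmannians. -/
noncomputable def multiLabel (V : MultiGr d) : MultiLabel d := fun i => label (V i)

theorem mem_multiCell_iff {L : MultiLabel d} {V : MultiGr d} :
    V ∈ multiCell L ↔ multiLabel V = L := by
  constructor
  · exact fun h => funext fun i => mem_grCell_iff_label.1 (h i)
  · rintro rfl i
    exact mem_grCell_iff_label.2 rfl

theorem multiLabel_multiFixedPt (L : MultiLabel d) : multiLabel (multiFixedPt L) = L :=
  funext fun i => label_fixedPt (L i)

theorem multiLabel_eq_of_mem_orbit {V V' : MultiGr d} (h : V' ∈ orbit d V) :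
    multiLabel V' = multiLabel V := by
  obtain ⟨g, hg, rfl⟩ := h
  exact funext fun i => label_map_of_mem_G hg (d i) (V i)

theorem Gr.map_mul {n k : ℕ} (g h : W n ≃ₗ[ℂ] W n) (V : Gr n k) :
    V.map (g * h) = (V.map h).map g :=
  Subtype.ext (Submodule.map_comp (h : W n →ₗ[ℂ] W n) (g : W n →ₗ[ℂ] W n) V.1)

theorem Gr.map_one {n k : ℕ} (V : Gr n k) : V.map (1 : W n ≃ₗ[ℂ] W n) = V :=
  Subtype.ext (Submodule.map_id V.1)

theorem mem_orbit_trans {V V' V'' : MultiGr d} (h : V' ∈ orbit d V) (h' : V'' ∈ orbit d V') :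
    V'' ∈ orbit d V := by
  obtain ⟨g, hg, rfl⟩ := h
  obtain ⟨g', hg', rfl⟩ := h'
  exact ⟨g' * g, (G n).mul_mem hg' hg, funext fun i => (Gr.map_mul (g' (d i)) (g (d i)) (V i)).symm⟩

theorem mem_orbit_symm {V V' : MultiGr d} (h : V' ∈ orbit d V) : V ∈ orbit d V' := by
  obtain ⟨g, hg, rfl⟩ := h
  refine ⟨g⁻¹, (G n).inv_mem hg, funext fun i => ?_⟩
  rw [← Gr.map_mul, ← Pi.mul_apply, inv_mul_cancel, Pi.one_apply, Gr.map_one]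

theorem orbit_eq_of_mem {V V' : MultiGr d} (h : V' ∈ orbit d V) : orbit d V' = orbit d V :=
  Set.ext fun _ => ⟨mem_orbit_trans h, mem_orbit_trans (mem_orbit_symm h)⟩

theorem mem_degFlag_of_mem_orbit (hd : StrictMono d) {V V' : MultiGr d} (hV : V ∈ degFlag d)
    (h : V' ∈ orbit d V) : V' ∈ degFlag d := by
  obtain ⟨g, hg, rfl⟩ := h
  rintro i hi _ ⟨_, ⟨x, hx, rfl⟩, rfl⟩
  have hle : d i ≤ d ⟨i + 1, hi⟩ := hd.monotone (Fin.le_def.2 (Nat.le_succ _))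
  exact ⟨_, hV i hi ⟨x, hx, rfl⟩, G_prBetween hg hle x⟩

/-! ### Labels of the points of the degenerate flag variety -/

/-- The orders at the two vertices agree on the indices that survive the projection, so a surviving
leading index remains leading. -/
theorem mem_leadSet_of_mem_degFlag (hd : StrictMono d) {V : MultiGr d} (hV : V ∈ degFlag d)
    {i : Fin s} (hi : (i : ℕ) + 1 < s) {l : Fin (n + 1)} (hl : l ∈ (multiLabel V i).1)
    (hlk : ¬((d i : ℕ) + 1 ≤ l ∧ (l : ℕ) < (d ⟨i + 1, hi⟩ : ℕ) + 1)) :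
    l ∈ (multiLabel V ⟨i + 1, hi⟩).1 := by
  have hlt : (d i : ℕ) < d ⟨i + 1, hi⟩ := hd (Fin.lt_def.2 (Nat.lt_succ_self _))
  obtain ⟨x, hx, hxl⟩ := mem_leadSet.1 hl
  refine mem_leadSet.2 ⟨_, hV i hi ⟨x, hx, rfl⟩, ?_, fun p hp => ?_⟩
  · rw [prBetween_apply, if_neg hlk]
    exact hxl.1
  · rw [prBetween_apply]
    split_ifs with hpk
    · rfl
    · refine hxl.2 p ?_
      have := p.2
      have := l.2
      unfold pos at hp ⊢
      split_ifs at hp ⊢ <;> omega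

theorem multiFixedPt_mem_degFlag_iff {L : MultiLabel d} : multiFixedPt L ∈ degFlag d ↔
    ∀ (i : Fin s) (hi : (i : ℕ) + 1 < s), ∀ l ∈ (L i).1,
      ¬((d i : ℕ) + 1 ≤ l ∧ (l : ℕ) < (d ⟨i + 1, hi⟩ : ℕ) + 1) → l ∈ (L ⟨i + 1, hi⟩).1 := by
  constructor
  · intro h i hi l hl hlk
    have hw : (w l : W n) ∈ (fixedPt (L i)).1 := Submodule.subset_span ⟨⟨l, hl⟩, rfl⟩
    have := h i hi (Submodule.mem_map_of_mem hw)
    rw [prBetween_w, if_neg hlk] at this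
    by_contra hc
    have := mem_fixedPt_iff.1 this l hc
    simp [w] at this
  · rintro h i hi _ ⟨x, hx, rfl⟩
    refine mem_fixedPt_iff.2 fun p hp => ?_
    rw [prBetween_apply]
    split_ifs with hpk
    · rfl
    · exact mem_fixedPt_iff.1 hx p fun hpL => hp (h i hi p hpL hpk)

theorem multiFixedPt_multiLabel_mem_degFlag (hd : StrictMono d) {V : MultiGr d}
    (hV : V ∈ degFlag d) : multiFixedPt (multiLabel V) ∈ degFlag d :=
  multiFixedPt_mem_degFlag_iff.2 fun _ hi _ hl => mem_leadSet_of_mem_degFlag hd hV hi hl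

theorem map_prBetween_le_of_mem_degFlag (hd : StrictMono d) {V : MultiGr d} (hV : V ∈ degFlag d)
    {i j : Fin s} (hij : i ≤ j) :
    (V i).1.map (prBetween n ((d i : ℕ) + 1) ((d j : ℕ) + 1)) ≤ (V j).1 := by
  obtain ⟨j, hj⟩ := j
  have hij' : (i : ℕ) ≤ j := hij
  clear hij
  induction j, hij' using Nat.le_induction with
  | base =>
    rintro _ ⟨x, hx, rfl⟩
    have : prBetween n ((d i : ℕ) + 1) ((d i : ℕ) + 1) x = x := by
      funext j
      rw [prBetween_apply, if_neg (by omega)]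
    change prBetween n ((d i : ℕ) + 1) ((d i : ℕ) + 1) x ∈ (V i).1
    rw [this]
    exact hx
  | succ j hij ih =>
    rintro _ ⟨x, hx, rfl⟩
    have hj' : j < s := by omega
    have h1 := hV ⟨j, hj'⟩ hj ⟨_, ih hj' ⟨x, hx, rfl⟩, rfl⟩
    have hle : d i ≤ d ⟨j, hj'⟩ := hd.monotone (Fin.le_def.2 hij)
    have hle' : d ⟨j, hj'⟩ ≤ d ⟨j + 1, hj⟩ := hd.monotone (Fin.le_def.2 (Nat.le_succ _))
    rw [Fin.le_def] at hle hle'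
    convert h1 using 1
    funext p
    simp only [prBetween_apply]
    split_ifs <;> first | rfl | omega

/-! ### The orbit of a point of the degenerate flag variety contains the point of its label -/

/-- The flag `b` selects the summand through `w_l`: projective for `true`, injective for `false`.
The vector `x`, placed at the vertex `u`, will be the image of `w_l`. Taking the first admissible
`i` makes its projections lie in all later `V_i` that need them. -/
theorem exists_generator (hd : StrictMono d) {V : MultiGr d} (hV : V ∈ degFlag d)
    (l : Fin (n + 1)) (b : Bool) : ∃ (u : ℕ) (x : W n), ((l : ℕ) < u ↔ b = true) ∧ x l = 1 ∧
      (∀ p, pos n u l < pos n u p → x p = 0) ∧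
      ∀ i, ((l : ℕ) < (d i : ℕ) + 1 ↔ b = true) → l ∈ (multiLabel V i).1 →
        prBetween n u ((d i : ℕ) + 1) x ∈ (V i).1 := by
  classical
  by_cases h : ∃ i, ((l : ℕ) < (d i : ℕ) + 1 ↔ b = true) ∧ l ∈ (multiLabel V i).1
  · set S := Finset.univ.filter fun i =>
      ((l : ℕ) < (d i : ℕ) + 1 ↔ b = true) ∧ l ∈ (multiLabel V i).1
    have hS : S.Nonempty := by
      obtain ⟨i, hi⟩ := h
      exact ⟨i, Finset.mem_filter.2 ⟨Finset.mem_univ _, hi⟩⟩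
    have h0 := (Finset.mem_filter.1 (S.min'_mem hS)).2
    set i₀ := S.min' hS
    obtain ⟨B, hB, hBt⟩ := exists_isRowChart_leadSet (pos_injective n ((d i₀ : ℕ) + 1)) (V i₀).1
    refine ⟨(d i₀ : ℕ) + 1, B l, h0.1, ?_, hBt l, fun i hi hl => ?_⟩
    · simpa using hB.2.1 l h0.2 l h0.2
    · exact map_prBetween_le_of_mem_degFlag hd hV
        (S.min'_le i (Finset.mem_filter.2 ⟨Finset.mem_univ _, hi, hl⟩))
        (Submodule.mem_map_of_mem (hB.row_mem l))
  -- No `V_i` constrains this summand, so `w_l` itself is used; `u` only has to lie on the right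
  -- side of `l`.
  · refine ⟨if b = true then (l : ℕ) + 1 else 0, w l, ?_, by simp [w], fun p hp => ?_,
      fun i hi hl => absurd ⟨i, hi, hl⟩ h⟩
    · split_ifs with hb <;> simp [hb]
    · have : p ≠ l := by rintro rfl; omega
      simp [w, this]

theorem multiFixedPt_multiLabel_mem_orbit (hd : StrictMono d) {V : MultiGr d}
    (hV : V ∈ degFlag d) : multiFixedPt (multiLabel V) ∈ orbit d V := by
  apply mem_orbit_symm
  choose u x hu hx1 hxt hxV using exists_generator hd hV
  let b : ℕ → Fin (n + 1) → Bool := fun v l => decide ((l : ℕ) < v)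
  -- For `v ≤ u` the projection is over an empty range, so the column is `x` itself. It is a lift of
  -- `x` to the earlier vertex because triangularity of `x` at `u` already makes the coordinates
  -- killed in between vanish.
  let col : ℕ → Fin (n + 1) → W n := fun v l => prBetween n (u l (b v l)) v (x l (b v l))
  have hu' : ∀ (v : ℕ) (l : Fin (n + 1)), (l : ℕ) < u l (b v l) ↔ (l : ℕ) < v := fun v l => by simp [hu, b]
  have hdiag : ∀ v l, col v l l = 1 := fun v l => by
    have := hu' v l
    simp only [col, prBetween_apply]
    rw [if_neg (by omega), hx1]
  have htri : ∀ v l p, pos n v l < pos n v p → col v l p = 0 := fun v l p h => by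
    have h1 := hu' v l
    simp only [col, prBetween_apply]
    split_ifs with hk
    · rfl
    · refine hxt _ _ p ?_
      have := p.2
      have := l.2
      unfold pos at h ⊢
      split_ifs at h ⊢ <;> omega
  let T : ℕ → W n →ₗ[ℂ] W n := fun v => Fintype.linearCombination ℂ (col v)
  have hT : ∀ v l, T v (w l) = col v l := fun v l => by
    simp [T, w, Fintype.linearCombination_apply, Pi.single_apply]
  have hinj : ∀ v, Function.Injective (T v) := fun v =>
    injective_of_triangular (pos_injective n v) (T v) (fun l p h => by rw [hT, htri v l p h])
      fun l => by rw [hT, hdiag]; exact one_ne_zero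
  refine ⟨fun k => LinearEquiv.ofInjectiveEndo (T (k + 1)) (hinj _), ⟨fun k hk y => ?_, fun k => ?_⟩,
    funext fun i => ?_⟩
  · simp only [LinearEquiv.coe_ofInjectiveEndo]
    suffices h : (T (k + 1 + 1)).comp (arrow n (k + 1)) = (arrow n (k + 1)).comp (T (k + 1)) from
      LinearMap.congr_fun h y
    refine (Pi.basisFun ℂ (Fin (n + 1))).ext fun l => ?_
    have hb : (Pi.basisFun ℂ (Fin (n + 1))) l = w l := by simp [w]
    rw [hb, LinearMap.comp_apply, LinearMap.comp_apply, hT, arrow, prBetween_w]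
    have hl := l.2
    split_ifs with hlk
    · have h1 := hu' (k + 1) l
      have h2 := hxt l (b (k + 1) l)
      rw [map_zero]
      funext p
      have hp := p.2
      simp only [col, prBetween_apply, Pi.zero_apply]
      split_ifs
      · rfl
      · rfl
      · refine (h2 p ?_).symm
        unfold pos
        split_ifs <;> omega
    · rw [hT]
      -- A surviving `w_l` stays in the same summand, so both columns come from the same generator.
      have hbb : b (k + 1 + 1) l = b (k + 1) l := by
        simp only [b, decide_eq_decide]
        omega
      have h1 := hu' (k + 1) l
      have h2 := hxt l (b (k + 1) l)
      funext p
      have hp := p.2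
      simp only [col, hbb, prBetween_apply]
      split_ifs <;> first
        | rfl
        | omega
        | (refine h2 p ?_
           unfold pos
           split_ifs <;> omega)
  · refine Submodule.eq_of_le_of_finrank_eq ?_ (LinearEquiv.finrank_map_eq _ _)
    rintro _ ⟨y, hy, rfl⟩
    refine mem_injPart_iff.2 fun j hj => ?_
    change T (k + 1) y j = 0
    rw [map_apply_eq_sum]
    refine Finset.sum_eq_zero fun l _ => ?_
    by_cases hl : (l : ℕ) < k + 1
    · rw [mem_injPart_iff.1 hy l hl, zero_mul]
    · rw [hT, htri, mul_zero]
      have := l.2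
      unfold pos
      rw [if_neg hl, if_pos hj]
      omega
  · refine (Subtype.ext ?_ : _ = _).symm
    refine Submodule.eq_of_le_of_finrank_eq ?_ (by rw [(V i).2]; exact (Gr.map _ _).2)
    rintro _ ⟨y, hy, rfl⟩
    change T (d i + 1) y ∈ (V i).1
    rw [eq_sum_smul_w y, map_sum]
    refine Submodule.sum_mem _ fun l _ => ?_
    rw [map_smul, hT]
    by_cases hl : l ∈ (multiLabel V i).1
    · exact Submodule.smul_mem _ _ (hxV l _ i (by simp [b]) hl)
    · rw [mem_fixedPt_iff.1 hy l hl, zero_smul]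
      exact Submodule.zero_mem _

/-- The orbit of `p_L` is the intersection of the degenerate flag variety with the cell. -/
theorem orbit_multiFixedPt (hd : StrictMono d) {L : MultiLabel d}
    (hL : multiFixedPt L ∈ degFlag d) :
    orbit d (multiFixedPt L) = degFlag d ∩ multiCell L := by
  ext V
  constructor
  · intro h
    refine ⟨mem_degFlag_of_mem_orbit hd hL h, mem_multiCell_iff.2 ?_⟩
    rw [multiLabel_eq_of_mem_orbit h, multiLabel_multiFixedPt]
  · rintro ⟨hV, hVL⟩
    rw [← mem_multiCell_iff.1 hVL]
    exact mem_orbit_symm (multiFixedPt_multiLabel_mem_orbit hd hV)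

theorem orbits_eq_labelledCells (hd : StrictMono d) : orbits d = labelledCells d := by
  ext C
  constructor
  · rintro ⟨V, hV, rfl⟩
    have h := multiFixedPt_multiLabel_mem_degFlag hd hV
    refine ⟨_, h, ?_⟩
    rw [← orbit_multiFixedPt hd h, orbit_eq_of_mem (multiFixedPt_multiLabel_mem_orbit hd hV)]
  · rintro ⟨L, hL, rfl⟩
    exact ⟨_, hL, (orbit_multiFixedPt hd hL).symm⟩

end OrbitsAndLabels

/-! ### Frames and minors -/

/-- The numbering of a label. -/
noncomputable def Label.equivFin {n k : ℕ} (L : Label n k) : L.1 ≃ Fin k :=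
  L.1.equivFinOfCardEq L.2

/-- The maximal minor of a `k`-tuple of vectors with columns in `L`. -/
noncomputable def minor {n k : ℕ} (L : Label n k) (A : Fin k → W n) : ℂ :=
  Matrix.det (Matrix.of fun a b => A a (L.equivFin.symm b).1)

theorem IsRowChart.exists_frame {n k : ℕ} {L : Label n k} {B : Fin (n + 1) → Fin (n + 1) → ℂ}
    {V : Gr n k} (h : IsRowChart L.1 B V.1) :
    ∃ hA : LinearIndependent ℂ (fun a : Fin k => (B (L.equivFin.symm a).1 : W n)),
      Gr.ofFrame ⟨_, hA⟩ = V := by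
  refine ⟨h.linearIndependent.comp _ L.equivFin.symm.injective, Subtype.ext ?_⟩
  have := h.span_eq
  rw [← L.equivFin.symm.surjective.range_comp] at this
  exact this

theorem isRowChart_fixedPt {n k : ℕ} (L : Label n k) :
    IsRowChart L.1 (fun l => if l ∈ L.1 then (w l : W n) else 0) (fixedPt L).1 := by
  refine ⟨fun l hl p => by simp [hl], fun l hl m _ => ?_, ?_⟩
  · simp [hl, w, Pi.single_apply, eq_comm]
  · apply le_antisymm
    · rw [Submodule.span_le]
      rintro _ ⟨l, rfl⟩
      by_cases hl : l ∈ L.1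
      · simp only [hl, if_true]
        exact Submodule.subset_span ⟨⟨l, hl⟩, rfl⟩
      · simp only [hl, if_false]
        exact Submodule.zero_mem _
    · change Submodule.span ℂ _ ≤ _
      rw [Submodule.span_le]
      rintro _ ⟨l, rfl⟩
      exact Submodule.subset_span ⟨l.1, by simp⟩

theorem fixedPt_exists_frame {n k : ℕ} (L : Label n k) :
    ∃ hA : LinearIndependent ℂ (fun a : Fin k => (w (L.equivFin.symm a).1 : W n)),
      Gr.ofFrame ⟨_, hA⟩ = fixedPt L := by
  have h : (fun a : Fin k => (w (L.equivFin.symm a).1 : W n)) = fun a : Fin k =>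
      if (L.equivFin.symm a).1 ∈ L.1 then (w (L.equivFin.symm a).1 : W n) else 0 :=
    funext fun a => (if_pos (L.equivFin.symm a).2).symm
  rw [h]
  exact (isRowChart_fixedPt L).exists_frame

/-- Two frames of one subspace differ by a square matrix, whose determinant is the common factor. -/
theorem exists_minor_eq_mul {n k : ℕ} {A B : {A : Fin k → W n // LinearIndependent ℂ A}}
    (h : Gr.ofFrame A = Gr.ofFrame B) : ∃ c : ℂ, ∀ L : Label n k, minor L B.1 = c * minor L A.1 := by
  have hspan : Submodule.span ℂ (Set.range A.1) = Submodule.span ℂ (Set.range B.1) :=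
    congrArg Subtype.val h
  have hB : ∀ a, ∃ c : Fin k → ℂ, ∑ b, c b • A.1 b = B.1 a := fun a => by
    rw [← Submodule.mem_span_range_iff_exists_fun, hspan]
    exact Submodule.subset_span ⟨a, rfl⟩
  choose T hT using hB
  refine ⟨Matrix.det (Matrix.of T), fun L => ?_⟩
  unfold minor
  rw [← Matrix.det_mul]
  congr 1
  ext a b
  simp [Matrix.mul_apply, ← hT a, Finset.sum_apply]

/-- The subspaces for which the minor of `M` is smaller than that of `L`. -/
def minorLT {n k : ℕ} (M L : Label n k) : Set (Gr n k) :=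
  {V | ∃ A, Gr.ofFrame A = V ∧ ‖minor M A.1‖ < ‖minor L A.1‖}

theorem ofFrame_mem_minorLT {n k : ℕ} {M L : Label n k}
    {B : {A : Fin k → W n // LinearIndependent ℂ A}} :
    Gr.ofFrame B ∈ minorLT M L ↔ ‖minor M B.1‖ < ‖minor L B.1‖ := by
  refine ⟨?_, fun h => ⟨B, rfl, h⟩⟩
  rintro ⟨A, hA, h⟩
  obtain ⟨t, ht⟩ := exists_minor_eq_mul hA
  obtain ⟨c, hc⟩ := exists_minor_eq_mul hA.symm
  -- If the factor vanished, so would all minors of `B` and then those of `A`, against the strict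
  -- inequality.
  have ht0 : t ≠ 0 := by
    rintro rfl
    rw [hc L, ht L, zero_mul, mul_zero, norm_zero] at h
    exact absurd h (not_lt.2 (norm_nonneg _))
  rw [ht, ht, norm_mul, norm_mul]
  exact mul_lt_mul_of_pos_left h (norm_pos_iff.2 ht0)

theorem isOpen_minorLT {n k : ℕ} (M L : Label n k) : IsOpen (minorLT M L) := by
  have hcont : ∀ N : Label n k, Continuous
      fun A : {A : Fin k → W n // LinearIndependent ℂ A} => ‖minor N A.1‖ := fun N => by
    refine (Continuous.matrix_det ?_).norm
    refine continuous_matrix fun a b => ?_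
    exact (continuous_apply (N.equivFin.symm b).1).comp
      ((continuous_apply (A := fun _ : Fin k => W n) a).comp continuous_subtype_val)
  refine isOpen_coinduced.2 ?_
  convert isOpen_lt (hcont M) (hcont L) using 1
  ext B
  exact ofFrame_mem_minorLT

theorem fixedPt_mem_minorLT {n k : ℕ} {M L : Label n k} (h : L ≠ M) :
    fixedPt L ∈ minorLT M L := by
  obtain ⟨hA, hAL⟩ := fixedPt_exists_frame L
  refine ⟨_, hAL, ?_⟩
  have h1 : minor L (fun a : Fin k => (w (L.equivFin.symm a).1 : W n)) = 1 := by
    unfold minor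
    convert Matrix.det_one (n := Fin k) (R := ℂ)
    ext a b
    simp [w, Pi.single_apply, Matrix.one_apply, eq_comm]
  have h2 : minor M (fun a : Fin k => (w (L.equivFin.symm a).1 : W n)) = 0 := by
    obtain ⟨m, hmM, hmL⟩ : ∃ m ∈ M.1, m ∉ L.1 := by
      by_contra hc
      push Not at hc
      exact h (Subtype.ext (Finset.eq_of_subset_of_card_le hc (by rw [M.2, L.2])).symm)
    refine Matrix.det_eq_zero_of_column_eq_zero (M.equivFin ⟨m, hmM⟩) fun a => ?_
    have hne : m ≠ (L.equivFin.symm a).1 := fun e => hmL (e ▸ (L.equivFin.symm a).2)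
    simp [w, hne]
  simp only [h1, h2]
  simp

/-- The points `p_L` are separated by open sets. -/
theorem label_eq_of_tendsto {n k : ℕ} {α : Type*} {F : Filter α} [F.NeBot] {f : α → Gr n k}
    {L M : Label n k} (hL : Tendsto f F (𝓝 (fixedPt L))) (hM : Tendsto f F (𝓝 (fixedPt M))) :
    L = M := by
  by_contra h
  have h1 := hL ((isOpen_minorLT M L).mem_nhds (fixedPt_mem_minorLT h))
  have h2 := hM ((isOpen_minorLT L M).mem_nhds (fixedPt_mem_minorLT (Ne.symm h)))
  obtain ⟨a, ha1, ha2⟩ := (Filter.Eventually.and h1 h2).exists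
  obtain ⟨A, hA, hlt⟩ := ha1
  rw [← hA] at ha2
  exact absurd (ofFrame_mem_minorLT.1 ha2) (not_lt.2 hlt.le)

/-! ### Limits of the one-dimensional torus -/

theorem IsRowChart.map_diagEquiv {n : ℕ} {J : Finset (Fin (n + 1))}
    {B : Fin (n + 1) → Fin (n + 1) → ℂ} {V : Submodule ℂ (W n)} (h : IsRowChart J B V)
    (t : Fin (n + 1) → ℂˣ) :
    IsRowChart J (fun l p => (t p : ℂ) / t l * B l p) (V.map (diagEquiv t : W n →ₗ[ℂ] W n)) := by
  have key : ∀ l, (diagEquiv t : W n →ₗ[ℂ] W n) (B l) =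
      (t l : ℂ) • fun p => (t p : ℂ) / t l * B l p := fun l => by
    funext p
    change (t p : ℂ) * B l p = (t l : ℂ) * ((t p : ℂ) / t l * B l p)
    field_simp [(t l).ne_zero]
  refine ⟨fun l hl p => by simp only [h.1 l hl p, mul_zero], fun l hl m hm => ?_, ?_⟩
  · simp only [h.2.1 l hl m hm]
    split_ifs with hlm
    · subst hlm
      simp
    · simp
  · rw [← h.2.2, Submodule.map_span]
    apply le_antisymm
    · rw [Submodule.span_le]
      rintro _ ⟨l, rfl⟩
      have : (fun p => (t p : ℂ) / t l * B l p) =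
          (t l : ℂ)⁻¹ • (diagEquiv t : W n →ₗ[ℂ] W n) (B l) := by
        rw [key, inv_smul_smul₀ (t l).ne_zero]
      simp only [this]
      exact Submodule.smul_mem _ _ (Submodule.subset_span ⟨_, ⟨l, rfl⟩, rfl⟩)
    · rw [Submodule.span_le]
      rintro _ ⟨_, ⟨l, rfl⟩, rfl⟩
      rw [key]
      exact Submodule.smul_mem _ _ (Submodule.subset_span ⟨l, rfl⟩)

/-- After dividing row `l` by its own weight, the reduced basis stays reduced and its entries before
`l` tend to `0`. These frames converge to the frame of `p_L`, and `Gr.ofFrame` is continuous. -/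
theorem tendsto_map_diagEquiv {n k : ℕ} {F : Filter ℂˣ} {deg : Fin (n + 1) → ℤ}
    (hF : ∀ p l, pos n k p < pos n k l →
      Tendsto (fun z : ℂˣ => (z : ℂ) ^ (deg p - deg l)) F (𝓝 0)) (V : Gr n k) :
    Tendsto (fun z : ℂˣ => V.map (diagEquiv fun j => z ^ deg j)) F (𝓝 (fixedPt (label V))) := by
  obtain ⟨B, hB, hBt⟩ := exists_isRowChart_leadSet (pos_injective n k) V.1
  have hz := fun z : ℂˣ => IsRowChart.exists_frame (L := label V)
    (V := V.map (diagEquiv fun j => z ^ deg j)) (hB.map_diagEquiv fun j => z ^ deg j)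
  obtain ⟨hA0, h0⟩ := fixedPt_exists_frame (label V)
  choose hA hV using hz
  rw [← h0]
  simp_rw [← hV]
  refine (continuous_coinduced_rng.tendsto _).comp ?_
  rw [tendsto_subtype_rng, tendsto_pi_nhds]
  intro a
  rw [tendsto_pi_nhds]
  intro p
  simp only
  set l := ((label V).equivFin.symm a) with hl
  have hlJ : l.1 ∈ leadSet (pos n k) V.1 := l.2
  have hzz : ∀ z : ℂˣ, ((z ^ deg p : ℂˣ) : ℂ) / ((z ^ deg l.1 : ℂˣ) : ℂ) =
      (z : ℂ) ^ (deg p - deg l.1) := fun z => by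
    rw [zpow_sub₀ z.ne_zero]
    simp
  simp_rw [hzz]
  rcases lt_trichotomy (pos n k p) (pos n k l.1) with h | h | h
  · have hne : p ≠ l.1 := by rintro e; rw [e] at h; omega
    simpa [w, hne] using (hF p l.1 h).mul_const (B l.1 p)
  · have := pos_injective n k h
    subst this
    simpa [w, hB.2.1 _ hlJ _ hlJ] using tendsto_const_nhds
  · have hne : p ≠ l.1 := by rintro e; rw [e] at h; omega
    simpa [w, hne, hBt l.1 p h] using tendsto_const_nhds

theorem tendsto_zpow_toZero {m : ℤ} (hm : 0 < m) :
    Tendsto (fun z : ℂˣ => (z : ℂ) ^ m) toZero (𝓝 0) := by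
  obtain ⟨k, rfl⟩ := Int.eq_ofNat_of_zero_le hm.le
  have hk : k ≠ 0 := by rintro rfl; simp at hm
  have h : Tendsto (fun z : ℂˣ => (z : ℂ)) toZero (𝓝 0) := tendsto_comap
  simpa [hk] using h.pow k

theorem tendsto_zpow_toInfinity {m : ℤ} (hm : m < 0) :
    Tendsto (fun z : ℂˣ => (z : ℂ) ^ m) toInfinity (𝓝 0) := by
  obtain ⟨k, hk⟩ := Int.eq_ofNat_of_zero_le (by omega : 0 ≤ -m)
  have hk0 : k ≠ 0 := by rintro rfl; simp at hk; omega
  have h : Tendsto (fun z : ℂˣ => (z : ℂ)⁻¹) toInfinity (𝓝 0) :=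
    tendsto_inv₀_cobounded.comp tendsto_comap
  have hm' : m = -(k : ℤ) := by omega
  subst hm'
  simpa [hk0] using h.pow k

instance toZero_neBot : toZero.NeBot := by
  refine comap_neBot_iff_frequently.2 ?_
  have h : ∃ᶠ z : ℂ in 𝓝 0, z ≠ 0 := by
    have : (𝓝[≠] (0 : ℂ)).NeBot := inferInstance
    exact frequently_mem_iff_neBot.2 this
  exact h.mono fun z hz => ⟨Units.mk0 z hz, rfl⟩

instance toInfinity_neBot : toInfinity.NeBot := by
  refine comap_neBot_iff_frequently.2 (Eventually.frequently ?_)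
  filter_upwards [Bornology.eventually_ne_cobounded (0 : ℂ)] with z hz
  exact ⟨Units.mk0 z hz, rfl⟩

section FixedPoints

variable {n s : ℕ} {d : Fin s → Fin n}

/-- Every point tends to the fixed point of its own label, and two fixed points cannot both be
limits. The hypothesis `hF` covers both tori, one with `λ → 0` and the other with `λ → ∞`. -/
theorem attractingSet_eq_orbit (hd : StrictMono d) {degP degI : ℕ → ℤ} {F : Filter ℂˣ} [F.NeBot]
    (hF : ∀ i p l, pos n ((d i : ℕ) + 1) p < pos n ((d i : ℕ) + 1) l →
      Tendsto (fun z : ℂˣ => (z : ℂ) ^ (basisDegree degP degI ((d i : ℕ) + 1) p -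
        basisDegree degP degI ((d i : ℕ) + 1) l)) F (𝓝 0))
    {L : MultiLabel d} (hL : multiFixedPt L ∈ degFlag d) :
    attractingSet (degFlag d) (torusAct d degP degI) F (multiFixedPt L) =
      orbit d (multiFixedPt L) := by
  rw [orbit_multiFixedPt hd hL]
  have key : ∀ (V : MultiGr d) i, Tendsto (fun z => torusAct d degP degI z V i) F
      (𝓝 (multiFixedPt (multiLabel V) i)) := fun V i => tendsto_map_diagEquiv (hF i) (V i)
  ext V
  refine and_congr_right fun _ => ?_
  rw [mem_multiCell_iff]
  constructor
  · intro h
    rw [tendsto_pi_nhds] at h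
    exact funext fun i => label_eq_of_tendsto (key V i) (h i)
  · rintro rfl
    exact tendsto_pi_nhds.2 (key V)

/-! ### Fixed points -/

theorem torusFixed_multiFixedPt (L : MultiLabel d) : TorusFixed (multiFixedPt L) :=
  fun t => funext fun i => map_diagEquiv_fixedPt (L i) t

theorem oneDimFixed_multiFixedPt (degP degI : ℕ → ℤ) (L : MultiLabel d) :
    OneDimFixed degP degI (multiFixedPt L) :=
  fun _ => funext fun i => map_diagEquiv_fixedPt (L i) _

theorem eq_multiFixedPt_of_map_diagEquiv {V : MultiGr d} (t : Fin s → Fin (n + 1) → ℂˣ)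
    (ht : ∀ i, Function.Injective (t i)) (h : ∀ i, (V i).map (diagEquiv (t i)) = V i) :
    V = multiFixedPt (multiLabel V) := by
  refine funext fun i => eq_fixedPt_of_diagonal_stable (fun p => (t i p : ℂ))
    (Units.val_injective.comp (ht i)) fun x hx => ?_
  have h1 := congrArg Subtype.val (h i)
  rw [← h1]
  exact ⟨x, hx, rfl⟩

theorem injective_two_zpow : Function.Injective fun m : ℤ => (Units.mk0 (2 : ℂ) two_ne_zero) ^ m := by
  intro a b h
  have h1 := congrArg (fun u : ℂˣ => ‖(u : ℂ)‖) h
  simp only [Units.val_zpow_eq_zpow_val, Units.val_mk0, norm_zpow, Complex.norm_ofNat] at h1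
  exact zpow_right_injective₀ (by norm_num) (by norm_num) h1

theorem eq_multiFixedPt_of_torusFixed {V : MultiGr d} (h : TorusFixed V) :
    V = multiFixedPt (multiLabel V) :=
  eq_multiFixedPt_of_map_diagEquiv
    -- One torus element with distinct diagonal entries suffices: the powers of `2`.
    (fun _ j => (Units.mk0 (2 : ℂ) two_ne_zero) ^ (((j : Fin (n + 1)) : ℕ) : ℤ))
    (fun _ _ _ hab => Fin.ext (Int.ofNat_injective (injective_two_zpow hab)))
    fun i => congrFun (h _) i

theorem eq_multiFixedPt_of_oneDimFixed {degP degI : ℕ → ℤ}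
    (hdeg : ∀ i : Fin s, Function.Injective
      (basisDegree degP degI ((d i : ℕ) + 1) : Fin (n + 1) → ℤ))
    {V : MultiGr d} (h : OneDimFixed degP degI V) : V = multiFixedPt (multiLabel V) :=
  eq_multiFixedPt_of_map_diagEquiv _ (fun i => injective_two_zpow.comp (hdeg i))
    fun i => congrFun (h (Units.mk0 2 two_ne_zero)) i

theorem torusFixed_iff {V : MultiGr d} : TorusFixed V ↔ ∃ L : MultiLabel d, V = multiFixedPt L := by
  refine ⟨fun h => ⟨_, eq_multiFixedPt_of_torusFixed h⟩, ?_⟩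
  rintro ⟨L, rfl⟩
  exact torusFixed_multiFixedPt L

theorem oneDimFixed_iff {degP degI : ℕ → ℤ}
    (hdeg : ∀ i : Fin s, Function.Injective
      (basisDegree degP degI ((d i : ℕ) + 1) : Fin (n + 1) → ℤ)) {V : MultiGr d} :
    OneDimFixed degP degI V ↔ TorusFixed V := by
  rw [torusFixed_iff]
  refine ⟨fun h => ⟨_, eq_multiFixedPt_of_oneDimFixed hdeg h⟩, ?_⟩
  rintro ⟨L, rfl⟩
  exact oneDimFixed_multiFixedPt _ _ L

/-- Admissible degrees decrease along the order at each vertex, hence the limit `λ → 0`; the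
standard degrees below increase, hence `λ → ∞`. -/
theorem AdmissibleDegrees.basisDegree_lt {degP degI : ℕ → ℤ} (h : AdmissibleDegrees n degP degI)
    (k : Fin n) {p l : Fin (n + 1)} (hpl : pos n (k + 1) p < pos n (k + 1) l) :
    basisDegree degP degI (k + 1) l < basisDegree degP degI (k + 1) p := by
  have := p.2
  have := l.2
  have := k.2
  unfold pos at hpl
  unfold basisDegree
  split_ifs at hpl ⊢
  all_goals first
    | exact h.proj _ _ (by omega) (by omega) (by omega)
    | exact h.proj_inj _ _ (by omega) (by omega) (by omega) (by omega)
    | exact h.inj _ _ (by omega) (by omega) (by omega)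
    | omega

theorem stdDegree_lt (k : Fin n) {p l : Fin (n + 1)} (hpl : pos n (k + 1) p < pos n (k + 1) l) :
    basisDegree (stdDegP n) stdDegI (k + 1) p < basisDegree (stdDegP n) stdDegI (k + 1) l := by
  have := p.2
  have := l.2
  have := k.2
  unfold pos at hpl
  unfold basisDegree stdDegP stdDegI
  split_ifs at hpl ⊢ <;> push_cast <;> omega

theorem AdmissibleDegrees.basisDegree_injective {degP degI : ℕ → ℤ}
    (h : AdmissibleDegrees n degP degI) (k : Fin n) :
    Function.Injective (basisDegree degP degI (k + 1) : Fin (n + 1) → ℤ) := by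
  intro a b hab
  rcases lt_trichotomy (pos n (k + 1) a) (pos n (k + 1) b) with h' | h' | h'
  · exact absurd hab (h.basisDegree_lt k h').ne'
  · exact pos_injective _ _ h'
  · exact absurd hab (h.basisDegree_lt k h').ne

theorem stdDegree_injective (k : Fin n) :
    Function.Injective (basisDegree (stdDegP n) stdDegI (k + 1) : Fin (n + 1) → ℤ) := by
  intro a b hab
  rcases lt_trichotomy (pos n (k + 1) a) (pos n (k + 1) b) with h' | h' | h'
  · exact absurd hab (stdDegree_lt k h').ne
  · exact pos_injective _ _ h'
  · exact absurd hab (stdDegree_lt k h').ne'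

end FixedPoints

/-! ### The equations of a cell in the chart of its label -/

section Cells

variable {n s : ℕ} {d : Fin s → Fin n}

/-- The indices killed by the projection between the `i`-th and the `(i+1)`-st subspace. -/
def Killed (d : Fin s → Fin n) (i : ℕ) (hi : i + 1 < s) (l : Fin (n + 1)) : Prop :=
  (d ⟨i, by omega⟩ : ℕ) + 1 ≤ l ∧ (l : ℕ) < (d ⟨i + 1, hi⟩ : ℕ) + 1

/-- The condition on labels characterising the points `p_L` of the degenerate flag variety. -/
def Linked (L : MultiLabel d) : Prop :=
  ∀ (i : ℕ) (hi : i + 1 < s), ∀ l ∈ (L ⟨i, by omega⟩).1, ¬Killed d i hi l → l ∈ (L ⟨i + 1, hi⟩).1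

theorem linked_of_mem_degFlag {L : MultiLabel d} (hL : multiFixedPt L ∈ degFlag d) : Linked L :=
  fun i hi => multiFixedPt_mem_degFlag_iff.1 hL ⟨i, by omega⟩ hi

theorem isChart_iff {J : Fin s → Finset (Fin (n + 1))} {A : Entry n s → ℂ} {V : MultiGr d} :
    IsChart J A V ↔ ∀ i, IsRowChart (J i) (fun l p => A (i, l, p)) (V i).1 := Iff.rfl

theorem IsChart.unique {J : Fin s → Finset (Fin (n + 1))} {A A' : Entry n s → ℂ} {V : MultiGr d}
    (h : IsChart J A V) (h' : IsChart J A' V) : A = A' := by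
  funext ⟨i, l, p⟩
  exact congrFun (congrFun ((isChart_iff.1 h i).unique (isChart_iff.1 h' i)) l) p

open Classical in
/-- The equations for the coordinates of the points of a cell: the matrices are triangular, and the
projections of the rows of each matrix lie in the span of the rows of the next one. -/
structure CellEquations (d : Fin s → Fin n) (A : Entry n s → ℂ) : Prop where
  tri : ∀ i l p, pos n ((d i : ℕ) + 1) l < pos n ((d i : ℕ) + 1) p → A (i, l, p) = 0
  rel : ∀ (i : ℕ) (hi : i + 1 < s) (l p : Fin (n + 1)),
    (if Killed d i hi p then 0 else A (⟨i, by omega⟩, l, p)) =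
      ∑ m, (if Killed d i hi m then 0 else A (⟨i, by omega⟩, l, m)) * A (⟨i + 1, hi⟩, m, p)

/-- A reduced triangular matrix has its pivots as leading indices. The coefficients of a projected
row in the next reduced basis are its own coordinates, which turns the incidence condition into
`rel`. -/
theorem mem_cell_iff {L : MultiLabel d} {V : MultiGr d} :
    V ∈ degFlag d ∩ multiCell L ↔ ∃ A, IsChart (fun i => (L i).1) A V ∧ CellEquations d A := by
  classical
  have hpr : ∀ (A : Entry n s → ℂ) (i : ℕ) (hi : i + 1 < s) (l : Fin (n + 1)),
      prBetween n ((d ⟨i, by omega⟩ : ℕ) + 1) ((d ⟨i + 1, hi⟩ : ℕ) + 1)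
        (fun p => A (⟨i, by omega⟩, l, p)) =
      fun p => if Killed d i hi p then 0 else A (⟨i, by omega⟩, l, p) := fun A i hi l => by
    funext p
    rw [prBetween_apply]
    exact if_congr Iff.rfl rfl rfl
  constructor
  · rintro ⟨hV, hVL⟩
    have hlab := mem_multiCell_iff.1 hVL
    subst hlab
    have hB := fun i => exists_isRowChart_leadSet (pos_injective n ((d i : ℕ) + 1)) (V i).1
    choose B hB hBt using hB
    refine ⟨fun e => B e.1 e.2.1 e.2.2, isChart_iff.2 hB, fun i l p h => hBt i l p h,
      fun i hi l p => ?_⟩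
    have h1 := hV ⟨i, by omega⟩ hi ⟨_, (hB ⟨i, by omega⟩).row_mem l, rfl⟩
    have h2 := congrFun ((hB ⟨i + 1, hi⟩).expand h1) p
    have h3 := hpr (fun e => B e.1 e.2.1 e.2.2) i hi l
    simp only at h3
    erw [h3] at h2
    simpa only [Finset.sum_apply, Pi.smul_apply, smul_eq_mul] using h2
  · rintro ⟨A, hA, hE⟩
    have hA' := isChart_iff.1 hA
    constructor
    · intro i hi
      rw [← (hA' i).2.2, Submodule.map_span, Submodule.span_le]
      rintro _ ⟨_, ⟨l, rfl⟩, rfl⟩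
      have h1 := hpr A i hi l
      change prBetween n ((d i : ℕ) + 1) ((d ⟨i + 1, hi⟩ : ℕ) + 1) (fun p => A (i, l, p)) ∈
        (V ⟨i + 1, hi⟩).1
      erw [h1]
      have h2 : (fun p => if Killed d i hi p then 0 else A (⟨i, by omega⟩, l, p)) =
          ∑ m, (if Killed d i hi m then 0 else A (⟨i, by omega⟩, l, m)) •
            (fun p => A (⟨i + 1, hi⟩, m, p)) := by
        funext p
        rw [hE.rel i hi l p]
        simp only [Finset.sum_apply, Pi.smul_apply, smul_eq_mul]
      rw [h2]
      exact Submodule.sum_mem _ fun m _ => Submodule.smul_mem _ _ ((hA' _).row_mem m)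
    · refine mem_multiCell_iff.2 (funext fun i => Subtype.ext ?_)
      exact (hA' i).leadSet_eq (pos_injective n _) (hE.tri i)

/-! ### Cells are locally closed -/

open Classical in
/-- The polynomials defining a cell in the chart of its label. -/
def cellPolynomials (d : Fin s → Fin n) : Set (MvPolynomial (Entry n s) ℂ) :=
  {H | (∃ i l p, pos n ((d i : ℕ) + 1) l < pos n ((d i : ℕ) + 1) p ∧
      H = MvPolynomial.X (i, l, p)) ∨
    ∃ (i : ℕ) (hi : i + 1 < s) (l p : Fin (n + 1)),
      H = (if Killed d i hi p then 0 else MvPolynomial.X (⟨i, by omega⟩, l, p)) -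
        ∑ m, (if Killed d i hi m then 0 else MvPolynomial.X (⟨i, by omega⟩, l, m)) *
          MvPolynomial.X (⟨i + 1, hi⟩, m, p)}

theorem cellEquations_iff {A : Entry n s → ℂ} :
    CellEquations d A ↔ ∀ H ∈ cellPolynomials d, MvPolynomial.eval A H = 0 := by
  classical
  constructor
  · rintro hE H (⟨i, l, p, h, rfl⟩ | ⟨i, hi, l, p, rfl⟩)
    · simpa using hE.tri i l p h
    · have := hE.rel i hi l p
      simp only [map_sub, map_sum, map_mul, apply_ite (MvPolynomial.eval A), map_zero,
        MvPolynomial.eval_X]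
      rw [this, sub_self]
  · intro h
    refine ⟨fun i l p hlp => ?_, fun i hi l p => ?_⟩
    · simpa using h _ (Or.inl ⟨i, l, p, hlp, rfl⟩)
    · have := h _ (Or.inr ⟨i, hi, l, p, rfl⟩)
      simp only [map_sub, map_sum, map_mul, apply_ite (MvPolynomial.eval A), map_zero,
        MvPolynomial.eval_X] at this
      exact sub_eq_zero.1 this

theorem isLocallyClosed_cell (L : MultiLabel d) :
    @IsLocallyClosed _ (zariski d) (degFlag d ∩ multiCell L) := by
  let _ := zariski d
  have hopen : ∀ J H, IsOpen (basicOpen d J H) := fun J H =>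
    TopologicalSpace.isOpen_generateFrom_of_mem ⟨J, H, rfl⟩
  -- The polynomial `1` gives the whole chart domain, inside which the cell is the common zero set
  -- of `cellPolynomials d`.
  have hZ : degFlag d ∩ multiCell L = basicOpen d (fun i => (L i).1) 1 ∩
      ⋂ H ∈ cellPolynomials d, (basicOpen d (fun i => (L i).1) H)ᶜ := by
    ext V
    rw [mem_cell_iff]
    constructor
    · rintro ⟨A, hA, hE⟩
      refine ⟨⟨A, hA, by simp⟩, Set.mem_iInter₂.2 fun H hH => ?_⟩
      rintro ⟨A', hA', h⟩
      rw [← hA.unique hA'] at h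
      exact h (cellEquations_iff.1 hE H hH)
    · rintro ⟨⟨A, hA, -⟩, h⟩
      refine ⟨A, hA, cellEquations_iff.2 fun H hH => ?_⟩
      by_contra hne
      exact Set.mem_iInter₂.1 h H hH ⟨A, hA, hne⟩
  rw [hZ]
  exact (hopen _ _).isLocallyClosed.inter
    (isClosed_biInter fun H _ => (hopen _ H).isClosed_compl).isLocallyClosed

/-! ### Cells are affine spaces -/

section Solution

variable {R : Type*} [CommRing R]

open Classical in
/-- A reduced triangular matrix with prescribed entries. -/
noncomputable def reducedMatrix (L : MultiLabel d) (x : Entry n s → R) (i : Fin s)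
    (l p : Fin (n + 1)) : R :=
  if l ∈ (L i).1 then
    if p ∈ (L i).1 then if l = p then 1 else 0
    else if pos n ((d i : ℕ) + 1) p < pos n ((d i : ℕ) + 1) l then x (i, l, p) else 0
  else 0

open Classical in
/-- The solution of the equations of a cell with prescribed values of the free coordinates. -/
noncomputable def solution (L : MultiLabel d) (x : Entry n s → R) :
    ∀ i : ℕ, i < s → Fin (n + 1) → Fin (n + 1) → R
  | 0, h => reducedMatrix L x ⟨0, h⟩
  | i + 1, h => fun l p =>
    if l ∈ (L ⟨i, by omega⟩).1 ∧ ¬Killed d i h l then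
      if p ∈ (L ⟨i + 1, h⟩).1 then if l = p then 1 else 0
      else if Killed d i h p then 0
      else solution L x i (by omega) l p -
        -- Since `m` is not in the preceding label, its row in the new matrix is free and given by
        -- `reducedMatrix`; this keeps the recursion from being circular.
        ∑ m with m ∈ (L ⟨i + 1, h⟩).1 ∧ m ∉ (L ⟨i, by omega⟩).1 ∧ ¬Killed d i h m,
          solution L x i (by omega) l m * reducedMatrix L x ⟨i + 1, h⟩ m p
    else reducedMatrix L x ⟨i + 1, h⟩ l p

/-- The free coordinates of a cell: the entries of the rows which are not determined by the
preceding matrix. -/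
def IsFree (L : MultiLabel d) (e : Entry n s) : Prop :=
  e.2.1 ∈ (L e.1).1 ∧ e.2.2 ∉ (L e.1).1 ∧
  pos n ((d e.1 : ℕ) + 1) e.2.2 < pos n ((d e.1 : ℕ) + 1) e.2.1 ∧
  ∀ (i : ℕ) (hi : i + 1 < s), (e.1 : ℕ) = i + 1 →
    ¬(e.2.1 ∈ (L ⟨i, by omega⟩).1 ∧ ¬Killed d i hi e.2.1)

theorem map_reducedMatrix {R' : Type*} [CommRing R'] (f : R →+* R') (L : MultiLabel d)
    (x : Entry n s → R) (i : Fin s) (l p : Fin (n + 1)) :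
    f (reducedMatrix L x i l p) = reducedMatrix L (fun e => f (x e)) i l p := by
  unfold reducedMatrix
  split_ifs <;> simp

/-- The solution uses only ring operations. Evaluating its generic version over a polynomial ring
shows that the parametrisation of the cell is polynomial. -/
theorem map_solution {R' : Type*} [CommRing R'] (f : R →+* R') (L : MultiLabel d)
    (x : Entry n s → R) (i : ℕ) (hi : i < s) (l p : Fin (n + 1)) :
    f (solution L x i hi l p) = solution L (fun e => f (x e)) i hi l p := by
  induction i generalizing l p with
  | zero => exact map_reducedMatrix f L x _ l p
  | succ i ih =>
    unfold solution
    split_ifs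
    · simp
    · simp
    · simp
    · simp only [map_sub, map_sum, map_mul, ih, map_reducedMatrix]
    · exact map_reducedMatrix f L x _ l p

variable {L : MultiLabel d} {x : Entry n s → R}

theorem reducedMatrix_of_mem {i : Fin s} {l p : Fin (n + 1)} (hl : l ∈ (L i).1)
    (hp : p ∈ (L i).1) : reducedMatrix L x i l p = if l = p then 1 else 0 := by
  unfold reducedMatrix
  rw [if_pos hl, if_pos hp]

theorem reducedMatrix_of_notMem {i : Fin s} {l p : Fin (n + 1)} (hl : l ∉ (L i).1) :
    reducedMatrix L x i l p = 0 := by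
  unfold reducedMatrix
  rw [if_neg hl]

theorem reducedMatrix_tri {i : Fin s} {l p : Fin (n + 1)}
    (h : pos n ((d i : ℕ) + 1) l < pos n ((d i : ℕ) + 1) p) : reducedMatrix L x i l p = 0 := by
  unfold reducedMatrix
  have hne : l ≠ p := by rintro rfl; omega
  split_ifs <;> first | rfl | omega

open Classical in
theorem solution_succ (i : ℕ) (hi : i + 1 < s) (l p : Fin (n + 1)) :
    solution L x (i + 1) hi l p =
      if l ∈ (L ⟨i, by omega⟩).1 ∧ ¬Killed d i hi l then
        if p ∈ (L ⟨i + 1, hi⟩).1 then if l = p then 1 else 0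
        else if Killed d i hi p then 0
        else solution L x i (by omega) l p -
          ∑ m with m ∈ (L ⟨i + 1, hi⟩).1 ∧ m ∉ (L ⟨i, by omega⟩).1 ∧ ¬Killed d i hi m,
            solution L x i (by omega) l m * reducedMatrix L x ⟨i + 1, hi⟩ m p
      else reducedMatrix L x ⟨i + 1, hi⟩ l p := by
  rw [solution]

theorem solution_of_notMem (hL : Linked L) {i : ℕ} {hi : i < s} {l : Fin (n + 1)}
    (hl : l ∉ (L ⟨i, hi⟩).1) (p : Fin (n + 1)) : solution L x i hi l p = 0 := by
  cases i with
  | zero => exact reducedMatrix_of_notMem hl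
  | succ i =>
    unfold solution
    rw [if_neg fun h => hl (hL i hi l h.1 h.2)]
    exact reducedMatrix_of_notMem hl

theorem solution_of_mem {i : ℕ} {hi : i < s} {l p : Fin (n + 1)}
    (hl : l ∈ (L ⟨i, hi⟩).1) (hp : p ∈ (L ⟨i, hi⟩).1) :
    solution L x i hi l p = if l = p then 1 else 0 := by
  cases i with
  | zero => exact reducedMatrix_of_mem hl hp
  | succ i =>
    unfold solution
    split_ifs with h h' <;> first
      | rfl
      | (rw [reducedMatrix_of_mem hl hp]; simp_all)

/-- Passing from one vertex to the next moves the block of killed indices from the beginning of the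
order to its end and leaves the order of the others unchanged. This and the next two lemmas record
these facts. -/
theorem pos_lt_of_killed (hd : StrictMono d) {i : ℕ} {hi : i + 1 < s} {l p : Fin (n + 1)}
    (hp : Killed d i hi p) (hl : ¬Killed d i hi l) :
    pos n ((d ⟨i + 1, hi⟩ : ℕ) + 1) l < pos n ((d ⟨i + 1, hi⟩ : ℕ) + 1) p := by
  have hlt : (d ⟨i, by omega⟩ : ℕ) < d ⟨i + 1, hi⟩ := hd (Fin.lt_def.2 (Nat.lt_succ_self _))
  have := p.2
  have := l.2
  unfold Killed at hp hl
  unfold pos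
  split_ifs <;> omega

theorem pos_lt_iff_of_not_killed (hd : StrictMono d) {i : ℕ} {hi : i + 1 < s} {l p : Fin (n + 1)}
    (hl : ¬Killed d i hi l) (hp : ¬Killed d i hi p) :
    pos n ((d ⟨i, by omega⟩ : ℕ) + 1) l < pos n ((d ⟨i, by omega⟩ : ℕ) + 1) p ↔
    pos n ((d ⟨i + 1, hi⟩ : ℕ) + 1) l < pos n ((d ⟨i + 1, hi⟩ : ℕ) + 1) p := by
  have hlt : (d ⟨i, by omega⟩ : ℕ) < d ⟨i + 1, hi⟩ := hd (Fin.lt_def.2 (Nat.lt_succ_self _))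
  have := p.2
  have := l.2
  unfold Killed at hp hl
  unfold pos
  split_ifs <;> omega

theorem pos_lt_of_killed_of_not_killed {i : ℕ} {hi : i + 1 < s} {l p : Fin (n + 1)}
    (hl : Killed d i hi l) (hp : ¬Killed d i hi p) :
    pos n ((d ⟨i, by omega⟩ : ℕ) + 1) l < pos n ((d ⟨i, by omega⟩ : ℕ) + 1) p := by
  have := p.2
  have := l.2
  unfold Killed at hp hl
  unfold pos
  split_ifs <;> omega

theorem solution_tri (hd : StrictMono d) {i : ℕ} {hi : i < s} {l p : Fin (n + 1)}
    (h : pos n ((d ⟨i, hi⟩ : ℕ) + 1) l < pos n ((d ⟨i, hi⟩ : ℕ) + 1) p) :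
    solution L x i hi l p = 0 := by
  classical
  induction i generalizing l p with
  | zero => exact reducedMatrix_tri h
  | succ i ih =>
    have hne : l ≠ p := by rintro rfl; omega
    unfold solution
    split_ifs with h1 h2 h3
    · rfl
    · rfl
    · rw [ih ((pos_lt_iff_of_not_killed hd h1.2 h3).2 h), zero_sub, neg_eq_zero]
      refine Finset.sum_eq_zero fun m hm => ?_
      obtain ⟨-, -, -, hmk⟩ := Finset.mem_filter.1 hm
      rcases lt_or_ge (pos n ((d ⟨i + 1, hi⟩ : ℕ) + 1) m) (pos n ((d ⟨i + 1, hi⟩ : ℕ) + 1) p)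
        with h5 | h5
      · rw [reducedMatrix_tri h5, mul_zero]
      · rw [ih ((pos_lt_iff_of_not_killed hd h1.2 hmk).2 (by omega)), zero_mul]
    · exact reducedMatrix_tri h

open Classical in
/-- The sum in the relations of a cell, split according to the rows of the second matrix. -/
theorem sum_relation {A A' : Fin (n + 1) → Fin (n + 1) → R} {i : ℕ} {hi : i + 1 < s}
    (hblock : ∀ l ∈ (L ⟨i, by omega⟩).1, ∀ m ∈ (L ⟨i, by omega⟩).1, A l m = if l = m then 1 else 0)
    (hzero : ∀ m ∉ (L ⟨i + 1, hi⟩).1, ∀ p, A' m p = 0)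
    {l : Fin (n + 1)} (hl : l ∈ (L ⟨i, by omega⟩).1) (hlk : ¬Killed d i hi l) (p : Fin (n + 1)) :
    ∑ m, (if Killed d i hi m then 0 else A l m) * A' m p = A' l p +
      ∑ m with m ∈ (L ⟨i + 1, hi⟩).1 ∧ m ∉ (L ⟨i, by omega⟩).1 ∧ ¬Killed d i hi m,
        A l m * A' m p := by
  have h : ∀ m, (if Killed d i hi m then 0 else A l m) * A' m p = (if m = l then A' l p else 0) +
      if m ∈ (L ⟨i + 1, hi⟩).1 ∧ m ∉ (L ⟨i, by omega⟩).1 ∧ ¬Killed d i hi m then A l m * A' m p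
      else 0 := fun m => by
    by_cases hlm : m = l
    · subst hlm
      simp [hlk, hl, hblock m hl m hl]
    · by_cases h1 : m ∈ (L ⟨i + 1, hi⟩).1
      · by_cases h2 : m ∈ (L ⟨i, by omega⟩).1
        · simp [hblock l hl m h2, Ne.symm hlm, hlm, h2]
        · by_cases h3 : Killed d i hi m
          · simp [h3, hlm]
          · simp [h1, h2, h3, hlm]
      · simp [hzero m h1, hlm]
  simp only [h]
  rw [Finset.sum_add_distrib, Finset.sum_ite_eq', if_pos (Finset.mem_univ l), Finset.sum_filter]

theorem solution_succ_of_not_carried {i : ℕ} {hi : i + 1 < s} {l p : Fin (n + 1)}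
    (h : ¬(l ∈ (L ⟨i, by omega⟩).1 ∧ ¬Killed d i hi l)) :
    solution L x (i + 1) hi l p = reducedMatrix L x ⟨i + 1, hi⟩ l p := by
  rw [solution_succ, if_neg h]

-- For a killed `l`, the row has only killed entries and its projection is zero. For a surviving
-- `l`, the relation contains row `l` of the next matrix with coefficient `1`, and `solution` is
-- defined by solving for that row.
open Classical in
theorem solution_rel (hd : StrictMono d) (hL : Linked L) (i : ℕ) (hi : i + 1 < s)
    (l p : Fin (n + 1)) :
    (if Killed d i hi p then 0 else solution L x i (by omega) l p) =
      ∑ m, (if Killed d i hi m then 0 else solution L x i (by omega) l m) *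
        solution L x (i + 1) hi m p := by
  by_cases hl : l ∈ (L ⟨i, by omega⟩).1
  swap
  · simp [solution_of_notMem hL hl]
  by_cases hlk : Killed d i hi l
  · have h0 : ∀ m, (if Killed d i hi m then 0 else solution L x i (by omega) l m) = 0 := fun m => by
      split_ifs with hm
      · rfl
      · exact solution_tri hd (pos_lt_of_killed_of_not_killed hlk hm)
    simp only [h0, zero_mul, Finset.sum_const_zero]
  rw [sum_relation (fun l hl m hm => solution_of_mem hl hm)
    (fun m hm p => solution_of_notMem hL hm p) hl hlk p]
  have hsum : ∑ m with m ∈ (L ⟨i + 1, hi⟩).1 ∧ m ∉ (L ⟨i, by omega⟩).1 ∧ ¬Killed d i hi m,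
      solution L x i (by omega) l m * solution L x (i + 1) hi m p =
      ∑ m with m ∈ (L ⟨i + 1, hi⟩).1 ∧ m ∉ (L ⟨i, by omega⟩).1 ∧ ¬Killed d i hi m,
      solution L x i (by omega) l m * reducedMatrix L x ⟨i + 1, hi⟩ m p :=
    Finset.sum_congr rfl fun m hm => by
      rw [solution_succ_of_not_carried fun h => (Finset.mem_filter.1 hm).2.2.1 h.1]
  rw [hsum]
  by_cases hp : p ∈ (L ⟨i + 1, hi⟩).1
  · have hpsum : ∑ m with m ∈ (L ⟨i + 1, hi⟩).1 ∧ m ∉ (L ⟨i, by omega⟩).1 ∧ ¬Killed d i hi m,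
        solution L x i (by omega) l m * reducedMatrix L x ⟨i + 1, hi⟩ m p =
        if p ∉ (L ⟨i, by omega⟩).1 ∧ ¬Killed d i hi p then solution L x i (by omega) l p else 0 := by
      split_ifs with h
      · rw [Finset.sum_eq_single p]
        · rw [reducedMatrix_of_mem hp hp, if_pos rfl, mul_one]
        · intro m hm hmp
          rw [reducedMatrix_of_mem (Finset.mem_filter.1 hm).2.1 hp, if_neg hmp, mul_zero]
        · exact fun hc => absurd (Finset.mem_filter.2 ⟨Finset.mem_univ _, hp, h⟩) hc
      · refine Finset.sum_eq_zero fun m hm => ?_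
        have hm' := (Finset.mem_filter.1 hm).2
        have hmp : m ≠ p := by rintro rfl; exact h hm'.2
        rw [reducedMatrix_of_mem hm'.1 hp, if_neg hmp, mul_zero]
    rw [hpsum, solution_of_mem (hL i hi l hl hlk) hp]
    by_cases hpk : Killed d i hi p
    · have hne : l ≠ p := by rintro rfl; exact hlk hpk
      simp [hpk, hne]
    · by_cases hp' : p ∈ (L ⟨i, by omega⟩).1
      · simp [hpk, hp', solution_of_mem hl hp']
      · have hne : l ≠ p := by rintro rfl; exact hp' hl
        simp [hpk, hp', hne]
  · rw [solution_succ, if_pos (show l ∈ (L ⟨i, by omega⟩).1 ∧ ¬Killed d i hi l from ⟨hl, hlk⟩), if_neg hp]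
    by_cases hpk : Killed d i hi p
    · rw [if_pos hpk, if_pos hpk, zero_add]
      refine (Finset.sum_eq_zero fun m hm => ?_).symm
      rw [reducedMatrix_tri (pos_lt_of_killed hd hpk (Finset.mem_filter.1 hm).2.2.2), mul_zero]
    · rw [if_neg hpk, if_neg hpk, sub_add_cancel]

end Solution

theorem eq_reducedMatrix {L : MultiLabel d} {A x : Entry n s → ℂ} (hE : CellEquations d A)
    (i : Fin s)
    (hzero : ∀ l ∉ (L i).1, ∀ p, A (i, l, p) = 0)
    (hblock : ∀ l ∈ (L i).1, ∀ m ∈ (L i).1, A (i, l, m) = if l = m then 1 else 0)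
    {l p : Fin (n + 1)}
    (hfree : l ∈ (L i).1 → p ∉ (L i).1 →
      pos n ((d i : ℕ) + 1) p < pos n ((d i : ℕ) + 1) l → A (i, l, p) = x (i, l, p)) :
    A (i, l, p) = reducedMatrix L x i l p := by
  unfold reducedMatrix
  split_ifs with hl hp hlp hpos
  · rw [hblock l hl p hp, if_pos hlp]
  · rw [hblock l hl p hp, if_neg hlp]
  · exact hfree hl hp hpos
  · refine hE.tri i l p (lt_of_le_of_ne (not_lt.1 hpos) fun h => hp ?_)
    rwa [← pos_injective _ _ h]
  · exact hzero l hl p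

/-- The coordinates of a point of a cell are determined by the free coordinates. -/
theorem CellEquations.eq_solution (hd : StrictMono d) {L : MultiLabel d} {V : MultiGr d} (hL : Linked L)
    {A x : Entry n s → ℂ} (hA : IsChart (fun i => (L i).1) A V) (hE : CellEquations d A)
    (hx : ∀ e, IsFree L e → A e = x e) (i : ℕ) (hi : i < s) (l p : Fin (n + 1)) :
    A (⟨i, hi⟩, l, p) = solution L x i hi l p := by
  classical
  have hred : ∀ (i : Fin s) (l p : Fin (n + 1)),
      (∀ (j : ℕ) (hj : j + 1 < s), (i : ℕ) = j + 1 →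
        ¬(l ∈ (L ⟨j, by omega⟩).1 ∧ ¬Killed d j hj l)) →
      A (i, l, p) = reducedMatrix L x i l p := fun i l p h =>
    eq_reducedMatrix hE i (hA i).1 (hA i).2.1 fun h1 h2 h3 => hx _ ⟨h1, h2, h3, h⟩
  induction i generalizing l p with
  | zero => exact hred _ l p fun j hj h => absurd h (by simp)
  | succ i ih =>
    replace ih := fun l p => ih (by omega) l p hred
    by_cases hc : l ∈ (L ⟨i, by omega⟩).1 ∧ ¬Killed d i hi l
    · have hl := hL i hi l hc.1 hc.2
      rw [solution_succ, if_pos hc]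
      split_ifs with h1 h2 h3
      · rw [(hA _).2.1 l hl p h1, if_pos h2]
      · rw [(hA _).2.1 l hl p h1, if_neg h2]
      · exact hE.tri _ l p (pos_lt_of_killed hd h3 hc.2)
      · have hrel := hE.rel i hi l p
        rw [if_neg h3, sum_relation (L := L) (A := fun l p => A (⟨i, by omega⟩, l, p))
          (A' := fun l p => A (⟨i + 1, hi⟩, l, p)) (hA _).2.1 (hA _).1 hc.1 hc.2 p] at hrel
        rw [← ih, hrel, eq_comm, sub_eq_iff_eq_add]
        congr 1
        refine Finset.sum_congr rfl fun m hm => ?_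
        rw [← ih, hred _ m p]
        -- The row `m` is not in the preceding label, so it is free and needs no induction
        -- hypothesis.
        intro j hj hij h
        obtain rfl : i = j := by simpa using hij
        exact (Finset.mem_filter.1 hm).2.2.1 h.1
    · rw [solution_succ_of_not_carried hc]
      refine hred _ l p fun j hj hij => ?_
      obtain rfl : i = j := by simpa using hij
      exact hc

/-- The point of a cell with given free coordinates. -/
theorem exists_isChart_solution {L : MultiLabel d} (hL : Linked L) (x : Entry n s → ℂ) :
    ∃ V : MultiGr d,
      IsChart (fun i => (L i).1) (fun e => solution L x e.1 e.1.2 e.2.1 e.2.2) V := by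
  have h : ∀ i : Fin s, IsRowChart (L i).1 (solution L x i i.2)
      (Submodule.span ℂ (Set.range (solution L x i i.2))) := fun i =>
    ⟨fun l hl p => solution_of_notMem hL hl p, fun l hl m hm => solution_of_mem hl hm, rfl⟩
  exact ⟨fun i => ⟨_, (h i).finrank.trans (L i).2⟩, isChart_iff.2 h⟩

/-- The parametrisation is `solution` as a function of the free entries; its inverse reads these
entries off the chart. Both are polynomial in the coordinates of a single chart, so all denominators
are `1`. -/
theorem isCell_of_linked (hd : StrictMono d) {L : MultiLabel d} (hL : Linked L) :
    IsCell (degFlag d ∩ multiCell L) := by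
  classical
  refine ⟨isLocallyClosed_cell L, ?_⟩
  let N := Fintype.card {e : Entry n s // IsFree L e}
  let σ : {e : Entry n s // IsFree L e} ≃ Fin N := Fintype.equivFin _
  -- Extension by `0` to the entries that are not free, over any ring: it is used both for complex
  -- points and for polynomial variables.
  let ext : {R : Type} → [CommRing R] → (Fin N → R) → Entry n s → R := fun y e =>
    if h : IsFree L e then y (σ ⟨e, h⟩) else 0
  choose point hpoint using fun x : Entry n s → ℂ => exists_isChart_solution hL x
  -- The value `0` outside the chart is irrelevant, since the cell lies inside it.
  let coord : MultiGr d → Entry n s → ℂ := fun V =>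
    if h : ∃ A, IsChart (fun i => (L i).1) A V then h.choose else 0
  have hcoord : ∀ {V : MultiGr d} {A}, IsChart (fun i => (L i).1) A V → coord V = A :=
    fun {V A} h => by
      have h' : ∃ A, IsChart (fun i => (L i).1) A V := ⟨A, h⟩
      simp only [coord, dif_pos h']
      exact h'.choose_spec.unique h
  refine ⟨N, fun y => point (ext y), fun V a => coord V (σ.symm a).1, ?_, ?_, ?_, ?_⟩
  · intro x₀
    refine ⟨fun i => (L i).1, fun e =>
      solution L (ext fun a => (MvPolynomial.X a : MvPolynomial (Fin N) ℂ)) e.1 e.1.2 e.2.1 e.2.2,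
      1, by simp, fun y _ => ?_⟩
    convert hpoint (ext y) using 1
    funext e
    rw [map_solution, map_one, div_one]
    congr 1
    funext e'
    simp only [ext]
    split_ifs <;> simp
  · ext V
    rw [mem_cell_iff]
    constructor
    · rintro ⟨y, rfl⟩
      exact ⟨_, hpoint (ext y), fun i l p h => solution_tri hd h,
        fun i hi l p => solution_rel hd hL i hi l p⟩
    · rintro ⟨A, hA, hE⟩
      refine ⟨fun a => A (σ.symm a).1, ?_⟩
      have hsol := hE.eq_solution hd hL hA
        (x := ext fun a => A (σ.symm a).1) (fun e he => by simp [ext, he])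
      have h1 := hpoint (ext fun a => A (σ.symm a).1)
      have h2 : A = fun e => solution L (ext fun a => A (σ.symm a).1) e.1 e.1.2 e.2.1 e.2.2 :=
        funext fun e => hsol e.1 e.1.2 e.2.1 e.2.2
      rw [← h2] at h1
      exact funext fun i => Subtype.ext (((h1 i).2.2).symm.trans (hA i).2.2)
  · intro y
    funext a
    obtain ⟨⟨⟨i, l, p⟩, he⟩, rfl⟩ := σ.surjective a
    change coord (point (ext y)) (σ.symm (σ ⟨(i, l, p), he⟩)).1 = _
    rw [hcoord (hpoint (ext y)), Equiv.symm_apply_apply]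
    have hval : ext y (i, l, p) = y (σ ⟨(i, l, p), he⟩) := by simp [ext, he]
    have hred : reducedMatrix L (ext y) i l p = ext y (i, l, p) := by
      unfold reducedMatrix
      rw [if_pos he.1, if_neg he.2.1, if_pos he.2.2.1]
    rw [← hval, ← hred]
    obtain ⟨i, hi⟩ := i
    cases i with
    | zero => rfl
    | succ i => exact solution_succ_of_not_carried (he.2.2.2 i hi rfl)
  · intro a z hz
    obtain ⟨A, hA, -⟩ := mem_cell_iff.1 hz
    refine ⟨fun i => (L i).1, MvPolynomial.X (σ.symm a).1, 1, ⟨A, hA, by simp⟩,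
      fun V _ A' hA' _ => ?_⟩
    simp only [hcoord hA']
    simp

/-! ### The decomposition into cells -/

instance (n k : ℕ) : Finite (Label n k) := by
  unfold Label
  infer_instance

theorem isCellularDecomposition_labelledCells (hd : StrictMono d) :
    IsCellularDecomposition (degFlag d) (labelledCells d) where
  finite := by
    refine (Set.finite_range fun L : MultiLabel d => degFlag d ∩ multiCell L).subset ?_
    rintro _ ⟨L, -, rfl⟩
    exact ⟨L, rfl⟩
  disjoint := by
    rintro _ ⟨L, -, rfl⟩ _ ⟨M, -, rfl⟩ hne
    refine Set.disjoint_left.2 fun V h1 h2 => hne ?_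
    rw [← mem_multiCell_iff.1 h1.2, ← mem_multiCell_iff.1 h2.2]
  union := by
    ext V
    constructor
    · rintro ⟨_, ⟨L, -, rfl⟩, h⟩
      exact h.1
    · intro hV
      exact ⟨_, ⟨_, multiFixedPt_multiLabel_mem_degFlag hd hV, rfl⟩, hV, mem_multiCell_iff.2 rfl⟩
  cell := by
    rintro _ ⟨L, hL, rfl⟩
    exact isCell_of_linked hd (linked_of_mem_degFlag hL)

end Cells

end DegFlag

/-! ### The theorem -/

theorem mainTheorem11 (n s : ℕ) (d : Fin s → Fin n) (hd : StrictMono d) :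
    -- the torus-fixed points are the points `p_{L^1, …, L^s}`
    (∀ V ∈ DegFlag.degFlag d,
      (DegFlag.TorusFixed V ↔ ∃ L : DegFlag.MultiLabel d, V = DegFlag.multiFixedPt L) ∧
      (∀ degP degI : ℕ → ℤ, DegFlag.AdmissibleDegrees n degP degI →
        (DegFlag.OneDimFixed degP degI V ↔ DegFlag.TorusFixed V)) ∧
      (DegFlag.OneDimFixed (DegFlag.stdDegP n) DegFlag.stdDegI V ↔ DegFlag.TorusFixed V)) ∧
    -- every orbit contains exactly one torus-fixed point
    (∀ V ∈ DegFlag.degFlag d, ∃! L : DegFlag.MultiLabel d,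
      DegFlag.multiFixedPt L ∈ DegFlag.orbit d V) ∧
    (∀ V ∈ DegFlag.degFlag d, ∃! x : DegFlag.MultiGr d,
      x ∈ DegFlag.orbit d V ∧ DegFlag.TorusFixed x) ∧
    -- the orbit of `p_{L^1, …, L^s}` is the intersection with the product of the cells
    (∀ L : DegFlag.MultiLabel d, DegFlag.multiFixedPt L ∈ DegFlag.degFlag d →
      DegFlag.orbit d (DegFlag.multiFixedPt L) = DegFlag.degFlag d ∩ DegFlag.multiCell L) ∧
    -- the orbits form a cellular decomposition, the same as that into labelled cells
    DegFlag.IsCellularDecomposition (DegFlag.degFlag d) (DegFlag.orbits d) ∧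
    DegFlag.orbits d = DegFlag.labelledCells d ∧
    -- the orbits are the attracting sets of the fixed points of the one-dimensional torus
    (∀ degP degI : ℕ → ℤ, DegFlag.AdmissibleDegrees n degP degI →
      ∀ x ∈ DegFlag.degFlag d, DegFlag.OneDimFixed degP degI x →
        DegFlag.attractingSet (DegFlag.degFlag d) (DegFlag.torusAct d degP degI)
          DegFlag.toZero x = DegFlag.orbit d x) ∧
    (∀ x ∈ DegFlag.degFlag d, DegFlag.OneDimFixed (DegFlag.stdDegP n) DegFlag.stdDegI x →
      DegFlag.attractingSet (DegFlag.degFlag d)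
        (DegFlag.torusAct d (DegFlag.stdDegP n) DegFlag.stdDegI)
          DegFlag.toInfinity x = DegFlag.orbit d x) := by
  have hadm : ∀ degP degI : ℕ → ℤ, DegFlag.AdmissibleDegrees n degP degI → ∀ V : DegFlag.MultiGr d,
      DegFlag.OneDimFixed degP degI V ↔ DegFlag.TorusFixed V :=
    fun _ _ h _ => DegFlag.oneDimFixed_iff fun i => h.basisDegree_injective (d i)
  have hstd : ∀ V : DegFlag.MultiGr d,
      DegFlag.OneDimFixed (DegFlag.stdDegP n) DegFlag.stdDegI V ↔ DegFlag.TorusFixed V :=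
    fun _ => DegFlag.oneDimFixed_iff fun i => DegFlag.stdDegree_injective (d i)
  refine ⟨fun V _ => ⟨DegFlag.torusFixed_iff, fun degP degI h => hadm degP degI h V, hstd V⟩,
    fun V hV => ⟨DegFlag.multiLabel V, DegFlag.multiFixedPt_multiLabel_mem_orbit hd hV,
      fun L hL => ?_⟩,
    fun V hV => ⟨DegFlag.multiFixedPt (DegFlag.multiLabel V),
      ⟨DegFlag.multiFixedPt_multiLabel_mem_orbit hd hV, DegFlag.torusFixed_multiFixedPt _⟩,
      fun x hx => ?_⟩,
    fun L hL => DegFlag.orbit_multiFixedPt hd hL, ?_, DegFlag.orbits_eq_labelledCells hd,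
    fun degP degI h x hx hfix => ?_, fun x hx hfix => ?_⟩
  · rw [← DegFlag.multiLabel_eq_of_mem_orbit hL, DegFlag.multiLabel_multiFixedPt]
  · rw [← DegFlag.multiLabel_eq_of_mem_orbit hx.1]
    exact DegFlag.eq_multiFixedPt_of_torusFixed hx.2
  · rw [DegFlag.orbits_eq_labelledCells hd]
    exact DegFlag.isCellularDecomposition_labelledCells hd
  · obtain ⟨L, rfl⟩ := DegFlag.torusFixed_iff.1 ((hadm degP degI h x).1 hfix)
    exact DegFlag.attractingSet_eq_orbit hd (fun i p l hpl =>
      DegFlag.tendsto_zpow_toZero (sub_pos.2 (h.basisDegree_lt (d i) hpl))) hx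
  · obtain ⟨L, rfl⟩ := DegFlag.torusFixed_iff.1 ((hstd x).1 hfix)
    exact DegFlag.attractingSet_eq_orbit hd (fun i p l hpl =>
      DegFlag.tendsto_zpow_toInfinity (sub_neg.2 (DegFlag.stdDegree_lt (d i) hpl))) hx
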